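/- Let $k$ be a field. A finite EI category is a small category with finitely many morphisms in which every endomorphism is an isomorphism. A finite EI quiver is a finite quiver without oriented cycles together with a finite group $f(v)$ for every vertex $v$ and a finite $(f(w),f(v))$-biset $g(a)$ for every arrow $a\colon v\to w$. It generates a finite EI category whose objects are the vertices, with $\operatorname{Aut}(v)=f(v)$ and, for $v\neq w$, $\operatorname{Hom}(v,w)=\bigsqcup_\gamma g(a_n)\times_{f(v_{n-1})}\cdots\times_{f(v_1)}g(a_1)$, where $\gamma$ runs over all directed paths $v=v_0\xrightarrow{a_1}v_1\to\cdots\xrightarrow{a_n}v_n=w$; composition is given by concatenation of paths and the biset product. A finite EI category is free if it is isomorphic to a category generated by a finite EI quiver. A morphism is unfactorizable if it is not an isomorphism and in every factorization of it as a composite of two morphisms one of the two factors is an isomorphism. Let $\mathcal{E}$ be a finite free EI category, and let its category algebra $k\mathcal{E}=\bigoplus_{n\ge 0}k\mathcal{E}_n$ (with the morphisms of $\mathcal{E}$ as basis and composition as product) carry the length grading: isomorphisms have degree $0$, and a composite of $n\ge 1$ unfactorizable morphisms has degree $n$. Call an object $x$ left regular if for every morphism $\alpha$ with target $x$ the stabilizer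 of $\alpha$ in $\operatorname{Aut}(x)$ has order invertible in $k$, and right regular if for every morphism $\beta$ with source $x$ the stabilizer of $\beta$ in $\operatorname{Aut}(x)$ has order invertible in $k$. If every object of $\mathcal{E}$ is left regular or right regular, then the graded algebra $k\mathcal{E}$ is quasi-Koszul: regarding $k\mathcal{E}_0=k\mathcal{E}/\bigoplus_{n\ge1}k\mathcal{E}_n$ as a left $k\mathcal{E}$-module, $$\operatorname{Ext}^1_{k\mathcal{E}}(k\mathcal{E}_0,k\mathcal{E}_0)\cdot\operatorname{Ext}^i_{k\mathcal{E}}(k\mathcal{E}_0,k\mathcal{E}_0)=\operatorname{Ext}^{i+1}_{k\mathcal{E}}(k\mathcal{E}_0,k\mathcal{E}_0)\qquad\text{for all } i\ge 0,$$ where the dot is the Yoneda product and the left-hand side denotes the span of all products; equivalently, the algebra $\operatorname{Ext}^*_{k\mathcal{E}}(k\mathcal{E}_0,k\mathcal{E}_0)$ is generated in degrees $0$ and $1$. -/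

import Mathlib

open CategoryTheory

universe t w v u

noncomputable section

/-! ### Bisets and their products -/

/-- A `(G, K)`-biset: a set with a left action of `G` and a commuting right action of `K`
(written as an action of the opposite group). -/
structure Biset (G K : Type w) [Group G] [Group K] where
  /-- the underlying set -/
  carrier : Type w
  [left : MulAction G carrier]
  [right : MulAction Kᵐᵒᵖ carrier]
  [comm : SMulCommClass G Kᵐᵒᵖ carrier]

namespace Biset

attribute [instance] Biset.left Biset.right Biset.comm

variable {G K L : Type w} [Group G] [Group K] [Group L]

/-- The group `G` as a `(G, G)`-biset. -/
def self (G : Type w) [Group G] : Biset G G where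
  carrier := G

/-- The relation `(x · k, y) ∼ (x, k · y)` on `X × Y`. -/
def Rel (X : Biset G K) (Y : Biset K L) (p q : X.carrier × Y.carrier) : Prop :=
  ∃ k : K, p.1 = MulOpposite.op k • q.1 ∧ q.2 = k • p.2

theorem leftAux (X : Biset G K) (Y : Biset K L) (g : G) (p q : X.carrier × Y.carrier)
    (h : Rel X Y p q) : Rel X Y (g • p.1, p.2) (g • q.1, q.2) := by
  obtain ⟨k, h1, h2⟩ := h
  exact ⟨k, by simp only [h1, smul_comm], h2⟩

theorem rightAux (X : Biset G K) (Y : Biset K L) (l : Lᵐᵒᵖ) (p q : X.carrier × Y.carrier)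
    (h : Rel X Y p q) : Rel X Y (p.1, l • p.2) (q.1, l • q.2) := by
  obtain ⟨k, h1, h2⟩ := h
  refine ⟨k, h1, ?_⟩
  simp only [h2]
  exact (smul_comm k l p.2).symm

/-- The biset product `X ×_K Y`, the quotient of `X × Y` by `(x · k, y) ∼ (x, k · y)`. -/
def prod (X : Biset G K) (Y : Biset K L) : Biset G L where
  carrier := Quot (Rel X Y)
  left :=
    { smul := fun g => Quot.map (fun p => (g • p.1, p.2)) (leftAux X Y g)
      one_smul := by
        rintro ⟨a, b⟩
        exact congrArg (Quot.mk _) (Prod.ext (one_smul _ _) rfl)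
      mul_smul := by
        rintro g h ⟨a, b⟩
        exact congrArg (Quot.mk _) (Prod.ext (mul_smul _ _ _) rfl) }
  right :=
    { smul := fun l => Quot.map (fun p => (p.1, l • p.2)) (rightAux X Y l)
      one_smul := by
        rintro ⟨a, b⟩
        exact congrArg (Quot.mk _) (Prod.ext rfl (one_smul _ _))
      mul_smul := by
        rintro g h ⟨a, b⟩
        exact congrArg (Quot.mk _) (Prod.ext rfl (mul_smul _ _ _)) }
  comm :=
    letI : SMul G (Quot (Rel X Y)) := ⟨fun g => Quot.map (fun p => (g • p.1, p.2)) (leftAux X Y g)⟩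
    letI : SMul Lᵐᵒᵖ (Quot (Rel X Y)) :=
      ⟨fun l => Quot.map (fun p => (p.1, l • p.2)) (rightAux X Y l)⟩
    ⟨by
      rintro g l ⟨a, b⟩
      rfl⟩

/-- The class of the pair `(x, y)` in the biset product. -/
def pair (X : Biset G K) (Y : Biset K L) (x : X.carrier) (y : Y.carrier) :
    (X.prod Y).carrier :=
  Quot.mk _ (x, y)

/-- A map of left `K`-sets `Y → Y'` induces a map of left `G`-sets `X ×_K Y → X ×_K Y'`. -/
def mapRight {L' : Type w} [Group L'] (X : Biset G K) {Y : Biset K L} {Y' : Biset K L'}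
    (φ : Y.carrier →[K] Y'.carrier) : (X.prod Y).carrier →[G] (X.prod Y').carrier where
  toFun := Quot.map (fun p => (p.1, φ p.2)) (by
    rintro ⟨a, b⟩ ⟨c, d⟩ ⟨k, h1, h2⟩
    refine ⟨k, h1, ?_⟩
    simp only at h2 ⊢
    rw [h2, map_smul])
  map_smul' := by
    rintro g ⟨a, b⟩
    rfl

end Biset

/-! ### Finite EI quivers and the categories they generate -/

/-- A finite EI quiver: a finite quiver without oriented cycles, a finite group at every vertex
and, for every arrow `a : x ⟶ y`, a finite `(grp y, grp x)`-biset. -/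
structure FiniteEIQuiver where
  /-- the vertices -/
  V : Type w
  [quiver : Quiver.{w} V]
  finite_vertices : Finite V
  finite_arrows : ∀ x y : V, Finite (x ⟶ y)
  acyclic : ∀ (x : V) (p : Quiver.Path x x), p = Quiver.Path.nil
  /-- the group at a vertex -/
  grp : V → Type w
  [group : ∀ x, Group (grp x)]
  finite_grp : ∀ x, Finite (grp x)
  /-- the biset at an arrow -/
  biset : ∀ {x y : V}, (x ⟶ y) → Biset (grp y) (grp x)
  finite_biset : ∀ {x y : V} (a : x ⟶ y), Finite (biset a).carrier

namespace FiniteEIQuiver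

attribute [instance] FiniteEIQuiver.quiver FiniteEIQuiver.group

variable (Q : FiniteEIQuiver.{w})

/-- The biset of a path: the iterated biset product `g(aₙ) × ⋯ × g(a₁)` over the groups at the
intermediate vertices. The innermost factor is the group at the source (the biset of the empty
path), which does not change the product up to isomorphism. -/
def pathBiset {x : Q.V} : ∀ {y : Q.V}, Quiver.Path x y → Biset (Q.grp y) (Q.grp x)
  | _, Quiver.Path.nil => Biset.self (Q.grp x)
  | _, Quiver.Path.cons p a => (Q.biset a).prod (pathBiset p)

/-- The product `H_q × H_p → H_{p q}` (first `p`, then `q`), for a fixed element of `H_p`, as a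
map of left sets. -/
def pathMul {x y : Q.V} (p : Quiver.Path x y) (h : (Q.pathBiset p).carrier) :
    ∀ {z : Q.V} (q : Quiver.Path y z),
      (Q.pathBiset q).carrier →[Q.grp z] (Q.pathBiset (p.comp q)).carrier
  | _, Quiver.Path.nil =>
      { toFun := fun g : Q.grp y => g • h
        map_smul' := fun g g' => mul_smul g g' h }
  | _, Quiver.Path.cons q a => Biset.mapRight (Q.biset a) (pathMul p h q)

/-- The morphisms from `x` to `y`: the disjoint union of the bisets of all paths from `x` to `y`.
As the quiver has no oriented cycles, the only path from `x` to itself is the empty one, and the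
endomorphisms of `x` are the elements of the group at `x`. -/
def Mor (x y : Q.V) : Type w :=
  Σ p : Quiver.Path x y, (Q.pathBiset p).carrier

/-- Composition, first `f`, then `g`. -/
def Mor.comp {x y z : Q.V} (f : Q.Mor x y) (g : Q.Mor y z) : Q.Mor x z :=
  ⟨f.1.comp g.1, Q.pathMul f.1 f.2 g.1 g.2⟩

/-- The identity of `x`: the unit of the group at `x`. -/
def Mor.id (x : Q.V) : Q.Mor x x :=
  ⟨Quiver.Path.nil, (1 : Q.grp x)⟩

/-- Extend a morphism by one element of the biset of one more arrow. -/
def Mor.cons {x y z : Q.V} (a : y ⟶ z) (b : (Q.biset a).carrier) (f : Q.Mor x y) : Q.Mor x z :=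
  ⟨f.1.cons a, Biset.pair (Q.biset a) (Q.pathBiset f.1) b f.2⟩

theorem Mor.id_comp {x y : Q.V} (f : Q.Mor x y) : Mor.comp Q (Mor.id Q x) f = f := by
  obtain ⟨p, h⟩ := f
  induction p with
  | nil => exact congrArg (Sigma.mk _) (mul_one (M := Q.grp x) h)
  | cons p a ih =>
    obtain ⟨b, h⟩ := h
    exact congrArg (Mor.cons Q a b) (ih h)

theorem Mor.comp_id {x y : Q.V} (f : Q.Mor x y) : Mor.comp Q f (Mor.id Q y) = f :=
  congrArg (Sigma.mk _) (one_smul (Q.grp y) f.2)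

theorem Mor.assoc {x y z t : Q.V} (f : Q.Mor x y) (g : Q.Mor y z) (h : Q.Mor z t) :
    Mor.comp Q (Mor.comp Q f g) h = Mor.comp Q f (Mor.comp Q g h) := by
  obtain ⟨r, h⟩ := h
  induction r with
  | nil => exact congrArg (Sigma.mk _) ((Q.pathMul f.1 f.2 g.1).map_smul' h g.2).symm
  | cons r a ih =>
    obtain ⟨b, h⟩ := h
    exact congrArg (Mor.cons Q a b) (ih h)

/-- The objects of the category generated by a finite EI quiver: its vertices. -/
structure Generated where
  /-- the vertex -/
  vertex : Q.V

/-- The category generated by a finite EI quiver. -/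
instance : Category.{w} Q.Generated where
  Hom x y := Q.Mor x.vertex y.vertex
  id x := Mor.id Q x.vertex
  comp f g := Mor.comp Q f g
  id_comp f := Mor.id_comp Q f
  comp_id f := Mor.comp_id Q f
  assoc f g h := Mor.assoc Q f g h

end FiniteEIQuiver

/-! ### Finite EI categories -/

section EI

variable (E : Type u) [Category.{v} E]

/-- The set of all morphisms of a category. -/
structure TotalHom where
  /-- the source -/
  src : E
  /-- the target -/
  tgt : E
  /-- the morphism -/
  hom : src ⟶ tgt

/-- A finite EI category: it has finitely many morphisms, and every endomorphism is an
isomorphism. -/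
class FiniteEICategory : Prop where
  finite_hom : Finite (TotalHom E)
  isIso_end : ∀ (x : E) (f : x ⟶ x), IsIso f

theorem FiniteEICategory.finite_obj [FiniteEICategory E] : Finite E := by
  have := FiniteEICategory.finite_hom (E := E)
  exact Finite.of_injective (fun x : E => (⟨x, x, 𝟙 x⟩ : TotalHom E))
    (fun x y h => congrArg TotalHom.src h)

/-- A finite EI category is free if it is isomorphic (by a functor that is bijective on objects
and on morphisms) to the category generated by some finite EI quiver. -/
def IsFreeEI : Prop :=
  ∃ (Q : FiniteEIQuiver.{w}) (F : E ⥤ Q.Generated),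
    F.Full ∧ F.Faithful ∧ Function.Bijective F.obj

variable {E}

/-- A morphism is unfactorizable if it is not an isomorphism and one factor of any
factorization of it is an isomorphism. -/
def Unfactorizable {x z : E} (α : x ⟶ z) : Prop :=
  ¬ IsIso α ∧ ∀ (y : E) (β : x ⟶ y) (γ : y ⟶ z), β ≫ γ = α → IsIso β ∨ IsIso γ

/-- `HasLength α n`: either `n = 0` and `α` is an isomorphism, or `n ≥ 1` and `α` is a composite
of `n` unfactorizable morphisms. -/
inductive HasLength : ∀ {x y : E}, (x ⟶ y) → ℕ → Prop
  | iso {x y : E} (α : x ⟶ y) (h : IsIso α) : HasLength α 0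
  | unfactorizable {x y : E} (α : x ⟶ y) (h : Unfactorizable α) : HasLength α 1
  | comp {x y z : E} (α : x ⟶ y) (β : y ⟶ z) (n : ℕ) (hα : HasLength α (n + 1))
      (hβ : Unfactorizable β) : HasLength (α ≫ β) (n + 2)

/-- The stabilizer in `Aut y` of a morphism `α` with target `y`. -/
def leftStabilizer {x y : E} (α : x ⟶ y) : Subgroup (Aut y) where
  carrier := {g | α ≫ g.hom = α}
  one_mem' := Category.comp_id α
  mul_mem' := by
    intro g h (hg : α ≫ g.hom = α) (hh : α ≫ h.hom = α)
    change α ≫ h.hom ≫ g.hom = α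
    rw [← Category.assoc, hh, hg]
  inv_mem' := by
    intro g (hg : α ≫ g.hom = α)
    exact (Iso.comp_inv_eq (α := (g : y ≅ y))).2 hg.symm

/-- The stabilizer in `Aut x` of a morphism `β` with source `x`. -/
def rightStabilizer {x y : E} (β : x ⟶ y) : Subgroup (Aut x) where
  carrier := {g | g.hom ≫ β = β}
  one_mem' := Category.id_comp β
  mul_mem' := by
    intro g h (hg : g.hom ≫ β = β) (hh : h.hom ≫ β = β)
    change (h.hom ≫ g.hom) ≫ β = β
    rw [Category.assoc, hg, hh]
  inv_mem' := by
    intro g (hg : g.hom ≫ β = β)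
    exact (Iso.inv_comp_eq (g : x ≅ x)).2 hg.symm

/-- The object `x` is left regular over `k`: the stabilizers in `Aut x` of all morphisms with
target `x` have order invertible in `k`. -/
def IsLeftRegularObj (k : Type t) [Field k] (x : E) : Prop :=
  ∀ (y : E) (α : y ⟶ x), IsUnit (Nat.card (leftStabilizer α) : k)

/-- The object `x` is right regular over `k`: the stabilizers in `Aut x` of all morphisms with
source `x` have order invertible in `k`. -/
def IsRightRegularObj (k : Type t) [Field k] (x : E) : Prop :=
  ∀ (y : E) (β : x ⟶ y), IsUnit (Nat.card (rightStabilizer β) : k)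

end EI

/-! ### The category algebra -/

/-- The category algebra `kE`: the vector space with basis the morphisms of `E`. -/
def CategoryAlgebra (k : Type t) [Field k] (E : Type u) [Category.{v} E] : Type (max t u v) :=
  TotalHom E →₀ k

namespace CategoryAlgebra

variable (k : Type t) [Field k] {E : Type u} [Category.{v} E]

instance : AddCommGroup (CategoryAlgebra k E) :=
  inferInstanceAs (AddCommGroup (TotalHom E →₀ k))

instance : Module k (CategoryAlgebra k E) :=
  inferInstanceAs (Module k (TotalHom E →₀ k))

/-- The basis element of a morphism. -/
def of (m : TotalHom E) : CategoryAlgebra k E :=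
  (Finsupp.single m 1 : TotalHom E →₀ k)

open Classical in
/-- The product of two basis elements, `β · α = β ∘ α` if the source of `β` is the target
of `α`, and zero otherwise. -/
def mulHom (β α : TotalHom E) : CategoryAlgebra k E :=
  if h : α.tgt = β.src then of k ⟨α.src, β.tgt, α.hom ≫ eqToHom h ≫ β.hom⟩ else 0

/-- The linear map on the category algebra with prescribed values on the basis. -/
def lift {M : Type*} [AddCommGroup M] [Module k M] (f : TotalHom E → M) :
    CategoryAlgebra k E →ₗ[k] M :=
  (Finsupp.linearCombination k f : (TotalHom E →₀ k) →ₗ[k] M)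

theorem lift_of {M : Type*} [AddCommGroup M] [Module k M] (f : TotalHom E → M)
    (m : TotalHom E) : lift k f (of k m) = f m := by
  refine (Finsupp.linearCombination_single k 1 m).trans (one_smul k _)

variable {k} in
theorem hom_ext {M : Type*} [AddCommGroup M] [Module k M] {f g : CategoryAlgebra k E →ₗ[k] M}
    (h : ∀ m, f (of k m) = g (of k m)) : f = g :=
  Finsupp.lhom_ext' (φ := (f : (TotalHom E →₀ k) →ₗ[k] M)) (ψ := g)
    (fun m => LinearMap.ext_ring (h m))

/-- The multiplication, extended bilinearly from the basis. -/
def mulLin : CategoryAlgebra k E →ₗ[k] CategoryAlgebra k E →ₗ[k] CategoryAlgebra k E :=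
  lift k (fun β => lift k (fun α => mulHom k β α))

theorem mulLin_of (β α : TotalHom E) : mulLin k (of k β) (of k α) = mulHom k β α := by
  rw [mulLin, lift_of, lift_of]

theorem mulLin_assoc (a b c : CategoryAlgebra k E) :
    mulLin k (mulLin k a b) c = mulLin k a (mulLin k b c) := by
  have h3 : ∀ γ β α : TotalHom E, mulLin k (mulLin k (of k γ) (of k β)) (of k α) =
      mulLin k (of k γ) (mulLin k (of k β) (of k α)) := by
    intro γ β α
    rw [mulLin_of, mulLin_of]
    obtain ⟨x, y, α⟩ := α
    obtain ⟨y', z, β⟩ := β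
    obtain ⟨z', t, γ⟩ := γ
    by_cases h1 : z = z'
    · subst h1
      by_cases h2 : y = y'
      · subst h2
        simp [mulHom, mulLin_of]
      · simp [mulHom, mulLin_of, h2]
    · by_cases h2 : y = y'
      · subst h2
        simp [mulHom, mulLin_of, h1]
      · simp [mulHom, h1, h2]
  have h2 : ∀ (γ β : TotalHom E) (c : CategoryAlgebra k E),
      mulLin k (mulLin k (of k γ) (of k β)) c = mulLin k (of k γ) (mulLin k (of k β) c) :=
    fun γ β => LinearMap.congr_fun (f := mulLin k (mulLin k (of k γ) (of k β)))
      (g := (mulLin k (of k γ)).comp (mulLin k (of k β))) (hom_ext (h3 γ β))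
  have h1 : ∀ (γ : TotalHom E) (b c : CategoryAlgebra k E),
      mulLin k (mulLin k (of k γ) b) c = mulLin k (of k γ) (mulLin k b c) :=
    fun γ b c => LinearMap.congr_fun (f := ((mulLin k).flip c).comp (mulLin k (of k γ)))
      (g := (mulLin k (of k γ)).comp ((mulLin k).flip c)) (hom_ext fun β => h2 γ β c) b
  exact LinearMap.congr_fun (f := ((mulLin k).flip c).comp ((mulLin k).flip b))
      (g := (mulLin k).flip (mulLin k b c)) (hom_ext fun γ => h1 γ b c) a

/-- The unit: the sum of the identities of all objects. -/
def unit (k : Type t) [Field k] (E : Type u) [Category.{v} E] : CategoryAlgebra k E :=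
  ∑ᶠ x : E, of k ⟨x, x, 𝟙 x⟩

theorem unit_mulLin [Finite E] (a : CategoryAlgebra k E) : mulLin k (unit k E) a = a := by
  classical
  have := Fintype.ofFinite E
  refine LinearMap.congr_fun (f := mulLin k (unit k E)) (g := LinearMap.id)
    (hom_ext fun m => ?_) a
  obtain ⟨x, y, α⟩ := m
  simp only [unit, finsum_eq_sum_of_fintype, map_sum, LinearMap.sum_apply, mulLin_of]
  rw [Finset.sum_eq_single y]
  · simp [mulHom]
  · intro z _ hz
    simp [mulHom, hz.symm]
  · simp

theorem mulLin_unit [Finite E] (a : CategoryAlgebra k E) : mulLin k a (unit k E) = a := by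
  classical
  have := Fintype.ofFinite E
  refine LinearMap.congr_fun (f := (mulLin k).flip (unit k E)) (g := LinearMap.id)
    (hom_ext fun m => ?_) a
  obtain ⟨x, y, α⟩ := m
  change mulLin k (of k ⟨x, y, α⟩) (unit k E) = of k ⟨x, y, α⟩
  simp only [unit, finsum_eq_sum_of_fintype, map_sum, mulLin_of]
  rw [Finset.sum_eq_single x]
  · simp [mulHom]
  · intro z _ hz
    simp [mulHom, hz]
  · simp

instance [FiniteEICategory E] : Ring (CategoryAlgebra k E) :=
  have : Finite E := FiniteEICategory.finite_obj E
  { (inferInstance : AddCommGroup (CategoryAlgebra k E)) with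
    mul := fun a b => mulLin k a b
    one := unit k E
    left_distrib := fun a b c => map_add (mulLin k a) b c
    right_distrib := fun a b c => LinearMap.map_add₂ (mulLin k) a b c
    zero_mul := fun a => LinearMap.map_zero₂ (mulLin k) a
    mul_zero := fun a => map_zero (mulLin k a)
    mul_assoc := mulLin_assoc k
    one_mul := unit_mulLin k
    mul_one := mulLin_unit k }

instance [FiniteEICategory E] : Algebra k (CategoryAlgebra k E) :=
  Algebra.ofModule (fun r a b => LinearMap.map_smul₂ (mulLin k) r a b)
    (fun r a b => map_smul (mulLin k a) r b)

/-- The length grading of the category algebra: the component of degree `n` is spanned by the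
morphisms of length `n`. -/
def lengthGrading (k : Type t) [Field k] (E : Type u) [Category.{v} E] (n : ℕ) :
    Submodule k (CategoryAlgebra k E) :=
  Submodule.span k {a | ∃ m : TotalHom E, HasLength m.hom n ∧ a = of k m}

end CategoryAlgebra

/-! ### Quasi-Koszul algebras -/

section QuasiKoszul

variable {k : Type t} [Field k] {A : Type u} [Ring A] [Algebra k A]
  (𝒜 : ℕ → Submodule k A) [GradedAlgebra 𝒜]

/-- The left `A`-module `A₀ = A / (A₁ ⊕ A₂ ⊕ ⋯)`. -/
def degreeZeroModule : ModuleCat.{u} A :=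
  ModuleCat.of A (A ⧸ (HomogeneousIdeal.irrelevant 𝒜).toIdeal)

/-- A positively graded algebra `A` is quasi-Koszul if
`Ext¹(A₀, A₀) · Extⁱ(A₀, A₀) = Extⁱ⁺¹(A₀, A₀)` for all `i ≥ 0`, where `Ext` is over `A` (without
grading), the dot is the Yoneda product and the left hand side is the additive group
generated by all products. (Here `x.comp y` is the Yoneda product `y · x`, first `x`, then `y`.) -/
def IsQuasiKoszulAlgebra : Prop :=
  ∀ i : ℕ, AddSubgroup.closure
    {z : Abelian.Ext (degreeZeroModule 𝒜) (degreeZeroModule 𝒜) (i + 1) |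
      ∃ (y : Abelian.Ext (degreeZeroModule 𝒜) (degreeZeroModule 𝒜) 1)
        (x : Abelian.Ext (degreeZeroModule 𝒜) (degreeZeroModule 𝒜) i),
        z = x.comp y rfl} = ⊤

end QuasiKoszul

end

/-! Write `A` for the category algebra, `J` for the ideal spanned by the morphisms of positive
length and `A₀ = A ⧸ J`. The theorem holds because `Extᵐ(A₀, A₀) = 0` for all `m ≥ 2`: for `i ≥ 1`
there is nothing to generate, and for `i = 0` one multiplies by the identity. Since `0 → J → A → A₀
→ 0` has projective middle term, it suffices that `Extᵐ(J, A₀) = 0` for `m ≥ 1`.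

In a free EI category every morphism of positive length is `f ≫ b` with `f` unfactorizable, uniquely
up to an automorphism of the middle object `y`. Hence `J` is the direct sum over `y` of the
coinvariants of `Aut y` on a projective module `X_y` with basis the pairs `(f, b)`; in other words,
of `A e_y ⊗ k[Last y]` over `k[Aut y]`. If `y` is left regular, `k[Last y]` is projective over
`k[Aut y]` and so is this summand over `A`. If `y` is right regular, `A e_y` is projective over
`k[Aut y]`, and `Ext` reduces to `Ext` over the self-injective algebra `k[Aut y]`.

The proof treats both cases at once. Either condition makes the stabilizer of every pair `(f, b)` of
invertible order, so there is a diagonal `k`-linear map `θ` on `X_y` with `∑ g θ g⁻¹ = 1`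
(`exists_weight`, `isTraceOne_pairScale`). This `θ` is not `A`-linear, but `A₀` is its own `k`-dual
(`isDualOfQuotient`), so homomorphisms `M → A₀` are just functionals on `M` vanishing on `J M`, and
those can be averaged with `θ`. For a module `X` with such a `θ`, the kernel of `X → X_H` is again a
module of coinvariants of the same kind (`IsTraceOne.trace_ker`), and homomorphisms from it to `A₀`
extend to `X` (`exists_extension`). Dimension shifting then gives `ext_coinvariants_eq_zero`. -/

noncomputable section

set_option linter.unusedSectionVars false

/-! ### Vanishing of `Ext` for coinvariants of a finite group action -/

section Coinvariants

variable {k : Type t} [Field k] {A : Type u} [Ring A] [Algebra k A] (J : Ideal A)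

/-- A linear functional on an `A`-module that vanishes on `J M`. -/
def VanishesOn {M : Type*} [AddCommGroup M] [Module A M] [Module k M] (l : M →ₗ[k] k) : Prop :=
  ∀ j ∈ J, ∀ m : M, l (j • m) = 0

/-- The functional `ε` identifies `S` with the `k`-dual of `A ⧸ J`. -/
structure IsDualOfQuotient {S : Type*} [AddCommGroup S] [Module A S] [Module k S]
    (ε : S →ₗ[k] k) : Prop where
  smul_eq_zero : ∀ j ∈ J, ∀ s : S, j • s = 0
  eq_zero : ∀ s : S, (∀ a : A, ε (a • s) = 0) → s = 0
  exists_repr : ∀ φ : A →ₗ[k] k, (∀ j ∈ J, φ j = 0) → ∃ s : S, ∀ a : A, ε (a • s) = φ a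

namespace IsDualOfQuotient

variable {J} {S : Type*} [AddCommGroup S] [Module A S] [Module k S] {ε : S →ₗ[k] k}
  (hS : IsDualOfQuotient J ε) {M : Type*} [AddCommGroup M] [Module A M] [Module k M]

include hS

theorem eq_of_forall {s s' : S} (h : ∀ a : A, ε (a • s) = ε (a • s')) : s = s' :=
  sub_eq_zero.1 (hS.eq_zero _ fun a => by rw [smul_sub, map_sub, h, sub_self])

theorem hom_ext {f g : M →ₗ[A] S} (h : ∀ m, ε (f m) = ε (g m)) : f = g := by
  ext m
  refine hS.eq_of_forall fun a => ?_
  rw [← map_smul, ← map_smul, h]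

/-- With `hom_ext`, this identifies homomorphisms into `S` with functionals vanishing on `J M`: the
image of `m` is the element representing `a ↦ l (a • m)`. -/
theorem exists_linearMap [IsScalarTower k A M] (l : M →ₗ[k] k) (hl : VanishesOn J l) :
    ∃ f : M →ₗ[A] S, ∀ m, ε (f m) = l m := by
  have key : ∀ m : M, ∃ s : S, ∀ a : A, ε (a • s) = l (a • m) := fun m =>
    hS.exists_repr
      { toFun := fun a => l (a • m)
        map_add' := fun a b => by rw [add_smul, map_add]
        map_smul' := fun c a => by simp [smul_assoc] }
      (fun j hj => hl j hj m)
  choose f hf using key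
  refine ⟨{ toFun := f, map_add' := fun m n => ?_, map_smul' := fun b m => ?_ }, fun m => ?_⟩
  · exact hS.eq_of_forall fun a => by rw [smul_add, map_add, hf, hf, hf, smul_add, map_add]
  · exact hS.eq_of_forall fun a => by
      rw [hf, RingHom.id_apply, smul_smul, smul_smul, hf]
  · simpa using hf m 1

end IsDualOfQuotient

/-! ### Finite group actions with an endomorphism of trace one -/

section Action

variable {H : Type*} [Group H] {X : Type*} [AddCommGroup X] [Module A X]

/-- The submodule spanned by the elements `h x - x`; the quotient by it is the module of
coinvariants. -/
def coinvariantsKer (ρ : H →* Module.End A X) : Submodule A X :=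
  Submodule.span A {z | ∃ h x, z = ρ h x - x}

theorem sub_mem_coinvariantsKer (ρ : H →* Module.End A X) (h : H) (x : X) :
    ρ h x - x ∈ coinvariantsKer ρ :=
  Submodule.subset_span ⟨h, x, rfl⟩

theorem act_mul (ρ : H →* Module.End A X) (g h : H) (x : X) : ρ (g * h) x = ρ g (ρ h x) := by
  rw [map_mul]; rfl

theorem act_one (ρ : H →* Module.End A X) (x : X) : ρ 1 x = x := by
  rw [map_one]; rfl

variable [Fintype H]

/-- A `k`-linear endomorphism `θ` of trace one under the action `ρ`, compatible with
functionals that vanish on `J X`. -/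
structure IsTraceOne [Module k X] (ρ : H →* Module.End A X) (θ : X →ₗ[k] X) : Prop where
  sum_eq : ∀ x, ∑ h, ρ h (θ (ρ h⁻¹ x)) = x
  vanishes : ∀ l : X →ₗ[k] k, VanishesOn J l → VanishesOn J (l ∘ₗ θ)

/-- The sum of the values of a function, as a linear map. -/
def sumMap (A : Type*) [Ring A] (H : Type*) [Fintype H] (X : Type*) [AddCommGroup X]
    [Module A X] : (H → X) →ₗ[A] X :=
  ∑ h, LinearMap.proj h

theorem sumMap_apply (y : H → X) : sumMap A H X y = ∑ h, y h := by
  simp [sumMap]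

/-- The diagonal action on functions `H → X`. -/
def diagAct (ρ : H →* Module.End A X) : H →* Module.End A (H → X) where
  toFun g := LinearMap.pi fun h => ρ g ∘ₗ LinearMap.proj (g⁻¹ * h)
  map_one' := by
    ext1 y; funext h
    simp
  map_mul' g g' := by
    ext1 y; funext h
    simp [mul_assoc]

theorem diagAct_apply (ρ : H →* Module.End A X) (g : H) (y : H → X) (h : H) :
    diagAct ρ g y h = ρ g (y (g⁻¹ * h)) := rfl

theorem sumMap_diagAct (ρ : H →* Module.End A X) (g : H) (y : H → X) :
    sumMap A H X (diagAct ρ g y) = ρ g (sumMap A H X y) := by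
  simp only [sumMap_apply, diagAct_apply, map_sum]
  exact Equiv.sum_comp (Equiv.mulLeft g⁻¹) (fun h => ρ g (y h))

/-- The action on the functions `H → X` with sum zero. -/
def kerAct (ρ : H →* Module.End A X) : H →* Module.End A (LinearMap.ker (sumMap A H X)) where
  toFun g := (diagAct ρ g).restrict fun y hy => by
    rw [LinearMap.mem_ker] at hy ⊢
    rw [sumMap_diagAct, hy, map_zero]
  map_one' := by
    ext1 y
    exact Subtype.ext (act_one (diagAct ρ) y.1)
  map_mul' g g' := by
    ext1 y
    exact Subtype.ext (act_mul (diagAct ρ) g g' y.1)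

theorem kerAct_coe (ρ : H →* Module.End A X) (g : H) (y : LinearMap.ker (sumMap A H X)) (h : H) :
    (kerAct ρ g y : H → X) h = ρ g ((y : H → X) (g⁻¹ * h)) := rfl

/-- The retraction of `H → X` onto the functions with sum zero. -/
def kerRetract (A : Type*) [Ring A] (H : Type*) [Group H] [Fintype H] (X : Type*)
    [AddCommGroup X] [Module A X] : (H → X) →ₗ[A] LinearMap.ker (sumMap A H X) :=
  letI : DecidableEq H := Classical.decEq H
  (LinearMap.id - LinearMap.single A (fun _ : H => X) 1 ∘ₗ sumMap A H X).codRestrict _ fun y => by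
    rw [LinearMap.mem_ker]
    simp [sumMap_apply (A := A)]

theorem kerRetract_coe (y : LinearMap.ker (sumMap A H X)) : kerRetract A H X y = y := by
  apply Subtype.ext
  have := y.2
  rw [LinearMap.mem_ker] at this
  simp [kerRetract, this]

/-- `kerRetract` subtracts the total of a function from its value at `1`. It is `A`-linear, though
not equivariant, and makes the kernel a summand of a finite power of `X`. -/
theorem projective_ker_sumMap [Module.Projective A X] :
    Module.Projective A (LinearMap.ker (sumMap A H X)) :=
  have : Module.Projective A (H → X) := .of_equiv (DFinsupp.linearEquivFunOnFintype (R := A) (M := fun _ : H => X))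
  Module.Projective.of_split (LinearMap.ker (sumMap A H X)).subtype (kerRetract A H X)
    (LinearMap.ext kerRetract_coe)

/-- The map `y ↦ ∑ h⁻¹ y(h)`, which identifies the coinvariants of the diagonal action on
`H → X` with `X`. -/
def untwist (ρ : H →* Module.End A X) : (H → X) →ₗ[A] X :=
  ∑ h, ρ h⁻¹ ∘ₗ LinearMap.proj h

theorem untwist_apply (ρ : H →* Module.End A X) (y : H → X) :
    untwist ρ y = ∑ h, ρ h⁻¹ (y h) := by
  simp [untwist]

theorem untwist_single [DecidableEq H] (ρ : H →* Module.End A X) (h : H) (x : X) :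
    untwist ρ (Pi.single h x) = ρ h⁻¹ x := by
  rw [untwist_apply, Finset.sum_eq_single h]
  · simp
  · intro b _ hb
    simp [hb]
  · simp

theorem untwist_mem (ρ : H →* Module.End A X) {y : H → X} (hy : sumMap A H X y = 0) :
    untwist ρ y ∈ coinvariantsKer ρ := by
  have : untwist ρ y = ∑ h, (ρ h⁻¹ (y h) - y h) := by
    rw [Finset.sum_sub_distrib, ← untwist_apply, ← sumMap_apply (A := A), hy, sub_zero]
  rw [this]
  exact Submodule.sum_mem _ fun h _ => sub_mem_coinvariantsKer ρ _ _

theorem exists_untwist (ρ : H →* Module.End A X) {x : X} (hx : x ∈ coinvariantsKer ρ) :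
    ∃ y : H → X, sumMap A H X y = 0 ∧ untwist ρ y = x := by
  classical
  have : coinvariantsKer ρ ≤ (LinearMap.ker (sumMap A H X)).map (untwist ρ) := by
    refine Submodule.span_le.2 ?_
    rintro _ ⟨h, x, rfl⟩
    -- Untwisting turns the entry `x` at `h⁻¹` into `h x` and leaves the entry at `1` unchanged.
    refine ⟨Pi.single h⁻¹ x - Pi.single 1 x, ?_, ?_⟩
    · rw [SetLike.mem_coe, LinearMap.mem_ker]
      simp [sumMap_apply]
    · simp [untwist_single]
  exact this hx

variable [Module k X] [IsScalarTower k A X]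

/-- `θ`, applied to the values of a function with sum zero. -/
def kerTrace (A : Type*) [Ring A] [Algebra k A] (H : Type*) [Fintype H] [Module A X]
    [IsScalarTower k A X] (θ : X →ₗ[k] X) :
    LinearMap.ker (sumMap A H X) →ₗ[k] LinearMap.ker (sumMap A H X) where
  toFun y := ⟨fun h => θ (y.1 h), by
    have := y.2
    simp only [LinearMap.mem_ker, sumMap, LinearMap.sum_apply, LinearMap.proj_apply] at this ⊢
    rw [← map_sum, this, map_zero]⟩
  map_add' y z := by ext h; simp
  map_smul' c y := by ext h; simp

theorem kerTrace_coe (θ : X →ₗ[k] X) (y : LinearMap.ker (sumMap A H X)) (h : H) :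
    (kerTrace A H θ y : H → X) h = θ ((y : H → X) h) := rfl

variable {J} {ρ : H →* Module.End A X} {θ : X →ₗ[k] X}

theorem vanishesOn_trace_pi (hθ : IsTraceOne J ρ θ) (l : (H → X) →ₗ[k] k)
    (hl : VanishesOn J l) (j : A) (hj : j ∈ J) (y : H → X) : l (fun h => θ (j • y h)) = 0 := by
  classical
  have : (fun h => θ (j • y h)) = ∑ h, Pi.single h (θ (j • y h)) :=
    (Finset.univ_sum_single _).symm
  rw [this, map_sum]
  refine Finset.sum_eq_zero fun h _ => ?_
  have hv : VanishesOn J (l ∘ₗ LinearMap.single k (fun _ : H => X) h) := by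
    intro j hj x
    have : (Pi.single h (j • x) : H → X) = j • Pi.single h x := by
      rw [← Pi.single_smul]
    simpa [this] using hl j hj (Pi.single h x)
  exact hθ.vanishes _ hv j hj (y h)

/-- This inheritance is what allows dimension shifting to be iterated. Since `θ` acts value by
value, the two translations of the argument cancel; functionals are extended along `kerRetract` to
reduce to all functions `H → X`. -/
theorem IsTraceOne.trace_ker (hθ : IsTraceOne J ρ θ) :
    IsTraceOne J (kerAct ρ) (kerTrace A H θ) where
  sum_eq y := by
    ext h
    rw [AddSubmonoidClass.coe_finsetSum, Finset.sum_apply]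
    refine Eq.trans (Finset.sum_congr rfl fun g _ => ?_) (hθ.sum_eq (y.1 h))
    rw [kerAct_coe, kerTrace_coe, kerAct_coe]
    simp
  vanishes l hl j hj y := by
    have hv : VanishesOn J (l ∘ₗ (kerRetract A H X).restrictScalars k) := by
      intro j hj z
      simpa using hl j hj (kerRetract A H X z)
    have := vanishesOn_trace_pi hθ _ hv j hj y.1
    refine Eq.trans (congrArg l ?_) this
    exact (kerRetract_coe (kerTrace A H θ (j • y))).symm

/-- The value at `h` of the norm `∑ g⁻¹ y` is `h` applied to the untwisted sum, so the norm is zero.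
With `z_g = θ (g⁻¹ y)`, trace one gives `y = ∑ g z_g`, while `∑ z_g = θ (∑ g⁻¹ y) = 0`; hence `y = ∑
(g z_g - z_g)`. -/
theorem mem_coinvariantsKer_of_untwist_eq_zero (hθ : IsTraceOne J ρ θ)
    (y : LinearMap.ker (sumMap A H X)) (hy : untwist ρ y.1 = 0) :
    y ∈ coinvariantsKer (kerAct ρ) := by
  have h0 : ∑ g, kerTrace A H θ (kerAct ρ g⁻¹ y) = 0 := by
    rw [← map_sum]
    convert map_zero (kerTrace A H θ)
    ext h
    rw [AddSubmonoidClass.coe_finsetSum, Finset.sum_apply]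
    have : ρ h (untwist ρ y.1) = 0 := by rw [hy, map_zero]
    rw [untwist_apply, map_sum] at this
    refine Eq.trans ?_ this
    rw [← Equiv.sum_comp (Equiv.mulRight h) fun x => ρ h (ρ x⁻¹ (y.1 x))]
    refine Finset.sum_congr rfl fun g _ => ?_
    rw [kerAct_coe, ← act_mul]
    simp
  have h1 := hθ.trace_ker.sum_eq y
  rw [← sub_zero (∑ h, _), ← h0, ← Finset.sum_sub_distrib] at h1
  rw [← h1]
  exact Submodule.sum_mem _ fun g _ => sub_mem_coinvariantsKer _ _ _

theorem untwist_diagAct (ρ : H →* Module.End A X) (h : H) (y : H → X) :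
    untwist ρ (diagAct ρ h y) = untwist ρ y := by
  rw [untwist_apply, untwist_apply, ← Equiv.sum_comp (Equiv.mulLeft h)]
  refine Finset.sum_congr rfl fun g _ => ?_
  rw [diagAct_apply, ← act_mul]
  simp

/-- An invariant homomorphism on the functions with sum zero extends to an invariant homomorphism
on all functions. -/
theorem exists_extension {S : Type*} [AddCommGroup S] [Module A S] [Module k S]
    [IsScalarTower k A S] {ε : S →ₗ[k] k} (hS : IsDualOfQuotient J ε) (hθ : IsTraceOne J ρ θ)
    (f : LinearMap.ker (sumMap A H X) →ₗ[A] S) (hf : ∀ h y, f (kerAct ρ h y) = f y) :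
    ∃ f' : X →ₗ[A] S, ∀ y : LinearMap.ker (sumMap A H X), f' (untwist ρ y.1) = f y := by
  classical
  -- `F` extends the functional of `f` to all functions, but is not invariant. Averaging it with `θ`
  -- gives the invariant functional `G`, which still extends the functional of `f` because `f` is
  -- invariant and `θ` has trace one.
  let F : (H → X) →ₗ[k] k :=
    ε ∘ₗ (f.restrictScalars k) ∘ₗ (kerRetract A H X).restrictScalars k
  have hF : VanishesOn J F := fun j hj y => by
    simp [F, hS.smul_eq_zero j hj]
  let θY : (H → X) →ₗ[k] (H → X) := LinearMap.pi fun h => θ ∘ₗ LinearMap.proj h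
  let G : (H → X) →ₗ[k] k :=
    ∑ g : H, F ∘ₗ θY ∘ₗ (diagAct ρ g⁻¹).restrictScalars k
  have hG : ∀ y, G y = ∑ g : H, F (θY (diagAct ρ g⁻¹ y)) := fun y => by simp [G]
  have hGinv : ∀ h y, G (diagAct ρ h y) = G y := by
    intro h y
    rw [hG, hG, ← Equiv.sum_comp (Equiv.mulLeft h)]
    refine Finset.sum_congr rfl fun g _ => ?_
    rw [← act_mul]
    simp
  have hGext : ∀ y : LinearMap.ker (sumMap A H X), G y.1 = ε (f y) := by
    intro y
    rw [hG, ← congrArg f (hθ.trace_ker.sum_eq y), map_sum, map_sum]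
    refine Finset.sum_congr rfl fun g _ => ?_
    rw [hf]
    change ε (f (kerRetract A H X (kerTrace A H θ (kerAct ρ g⁻¹ y)).1)) = _
    rw [kerRetract_coe]
  -- An invariant functional on `H → X` is determined by its values on functions supported at `1`,
  -- hence factors through `untwist`.
  let l : X →ₗ[k] k := G ∘ₗ LinearMap.single k (fun _ : H => X) 1
  have hl : VanishesOn J l := by
    intro j hj x
    change G (Pi.single 1 (j • x)) = 0
    have hs : (Pi.single 1 (j • x) : H → X) = j • Pi.single 1 x := by rw [← Pi.single_smul]
    rw [hs, hG]
    refine Finset.sum_eq_zero fun g _ => ?_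
    rw [map_smul]
    exact vanishesOn_trace_pi hθ F hF j hj _
  have hGl : ∀ y, G y = l (untwist ρ y) := by
    intro y
    have h1 : y = ∑ h, Pi.single h (y h) := (Finset.univ_sum_single y).symm
    rw [untwist_apply, map_sum]
    conv_lhs => rw [h1]
    rw [map_sum]
    refine Finset.sum_congr rfl fun h _ => ?_
    rw [← hGinv h⁻¹]
    change _ = G (Pi.single 1 _)
    congr 1
    funext g
    rw [diagAct_apply]
    by_cases hg : g = 1
    · subst hg; simp
    · simp [hg]
  obtain ⟨f', hf'⟩ := hS.exists_linearMap l hl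
  refine ⟨f', fun y => ?_⟩
  have := hS.hom_ext (f := f' ∘ₗ untwist ρ ∘ₗ (LinearMap.ker (sumMap A H X)).subtype) (g := f)
    (fun m => by
      change ε (f' (untwist ρ m.1)) = _
      rw [hf', ← hGl, hGext])
  exact LinearMap.congr_fun this y

end Action

/-! ### Dimension shifting -/

section Ext

/-- The short exact sequence of a surjective linear map. -/
def kerShortComplex {X M : Type u} [AddCommGroup X] [Module A X] [AddCommGroup M] [Module A M]
    (π : X →ₗ[A] M) : ShortComplex (ModuleCat.{u} A) :=
  ShortComplex.mk (ModuleCat.ofHom (LinearMap.ker π).subtype) (ModuleCat.ofHom π) (by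
    ext x
    exact x.2)

theorem kerShortComplex_shortExact {X M : Type u} [AddCommGroup X] [Module A X] [AddCommGroup M]
    [Module A M] {π : X →ₗ[A] M} (hπ : Function.Surjective π) :
    (kerShortComplex π).ShortExact where
  exact := by
    rw [ShortComplex.ShortExact.moduleCat_exact_iff_function_exact]
    exact LinearMap.exact_subtype_ker_map π
  mono_f := (ModuleCat.mono_iff_injective _).2 Subtype.val_injective
  epi_g := (ModuleCat.epi_iff_surjective _).2 hπ

theorem ext_succ_eq_extClass_comp {X M : Type u} [AddCommGroup X] [Module A X] [AddCommGroup M]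
    [Module A M] [Module.Projective A X] {π : X →ₗ[A] M} (hπ : Function.Surjective π)
    {S : ModuleCat.{u} A} {n : ℕ} (e : Abelian.Ext (ModuleCat.of A M) S (n + 1)) :
    ∃ e' : Abelian.Ext (ModuleCat.of A (LinearMap.ker π)) S n,
      (kerShortComplex_shortExact hπ).extClass.comp e' (add_comm 1 n) = e := by
  have : Projective (kerShortComplex π).X₂ :=
    ModuleCat.projective_of_categoryTheory_projective (ModuleCat.of A X)
  exact Abelian.Ext.contravariant_sequence_exact₃ (kerShortComplex_shortExact hπ) S e
    (Abelian.Ext.eq_zero_of_projective _) (add_comm 1 n)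

/-- Every class in `Ext¹` is the connecting image of a homomorphism on the kernel, and the
connecting map kills those that extend to `X`. -/
theorem ext_eq_zero_of_extension {X M : Type u} [AddCommGroup X] [Module A X] [AddCommGroup M]
    [Module A M] [Module.Projective A X] {π : X →ₗ[A] M} (hπ : Function.Surjective π)
    {S : ModuleCat.{u} A}
    (h : ∀ f : LinearMap.ker π →ₗ[A] S, ∃ f' : X →ₗ[A] S, f' ∘ₗ (LinearMap.ker π).subtype = f)
    (e : Abelian.Ext (ModuleCat.of A M) S 1) : e = 0 := by
  obtain ⟨e', rfl⟩ := ext_succ_eq_extClass_comp hπ (n := 0) e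
  obtain ⟨f, rfl⟩ := (Abelian.Ext.mk₀_bijective _ _).2 e'
  obtain ⟨f', hf'⟩ := h f.hom
  have : f = (kerShortComplex π).f ≫ ModuleCat.ofHom f' := by
    ext1
    exact hf'.symm
  refine (congrArg (fun z => (kerShortComplex_shortExact hπ).extClass.comp z (add_comm 1 0))
    ((congrArg Abelian.Ext.mk₀ this).trans (Abelian.Ext.mk₀_comp_mk₀ _ _).symm)).trans ?_
  exact (kerShortComplex_shortExact hπ).extClass_comp_assoc _

variable {J}

/-- Let a finite group `H` act on a projective module `X`, with an endomorphism of trace one.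
Then `Extⁿ⁺¹` from the coinvariants to the dual of `A ⧸ J` vanishes. -/
theorem ext_coinvariants_eq_zero {H : Type u} [Group H] [Fintype H] {S : ModuleCat.{u} A}
    [Module k S] [IsScalarTower k A S] {ε : S →ₗ[k] k} (hS : IsDualOfQuotient J ε) (n : ℕ) :
    ∀ (X : Type u) [AddCommGroup X] [Module A X] [Module k X] [IsScalarTower k A X]
      [Module.Projective A X] (ρ : H →* Module.End A X) (θ : X →ₗ[k] X)
      (_ : IsTraceOne J ρ θ) (M : Type u) [AddCommGroup M] [Module A M] (π : X →ₗ[A] M)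
      (_ : Function.Surjective π) (_ : LinearMap.ker π = coinvariantsKer ρ)
      (e : Abelian.Ext (ModuleCat.of A M) S (n + 1)), e = 0 := by
  -- The coinvariants of `H → X` are `X`, and untwisting presents the kernel of `X → M` as an
  -- invariant quotient of the functions with sum zero.
  have key : ∀ (X : Type u) [AddCommGroup X] [Module A X] (ρ : H →* Module.End A X) (M : Type u)
      [AddCommGroup M] [Module A M] (π : X →ₗ[A] M) (_ : LinearMap.ker π = coinvariantsKer ρ),
      ∃ φ : LinearMap.ker (sumMap A H X) →ₗ[A] LinearMap.ker π,
        (∀ y, (φ y : X) = untwist ρ y.1) ∧ Function.Surjective φ ∧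
        ∀ h y, φ (kerAct ρ h y) = φ y := by
    intro X _ _ ρ M _ _ π hker
    refine ⟨(untwist ρ ∘ₗ (LinearMap.ker (sumMap A H X)).subtype).codRestrict _ fun y => ?_,
      fun y => rfl, ?_, ?_⟩
    · rw [hker]
      exact untwist_mem ρ y.2
    · rintro ⟨x, hx⟩
      rw [hker] at hx
      obtain ⟨y, hy, rfl⟩ := exists_untwist ρ hx
      exact ⟨⟨y, hy⟩, rfl⟩
    · intro h y
      exact Subtype.ext (untwist_diagAct ρ h y.1)
  induction n with
  | zero =>
    intro X _ _ _ _ _ ρ θ hθ M _ _ π hπ hker e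
    obtain ⟨φ, hφ, hsurj, hinv⟩ := key X ρ M π hker
    refine ext_eq_zero_of_extension hπ (fun f => ?_) e
    obtain ⟨f', hf'⟩ := exists_extension hS hθ (f ∘ₗ φ) fun h y => congrArg f (hinv h y)
    refine ⟨f', LinearMap.ext fun x => ?_⟩
    obtain ⟨y, rfl⟩ := hsurj x
    exact (congrArg f' (hφ y)).trans (hf' y)
  | succ n ih =>
    intro X _ _ _ _ _ ρ θ hθ M _ _ π hπ hker e
    obtain ⟨φ, hφ, hsurj, hinv⟩ := key X ρ M π hker
    obtain ⟨e', rfl⟩ := ext_succ_eq_extClass_comp hπ e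
    have : Module.Projective A (LinearMap.ker (sumMap A H X)) := projective_ker_sumMap
    -- The induction hypothesis applies to `ker π`, once the kernel of `φ` is shown to be no larger
    -- than what coinvariance forces.
    rw [ih _ (kerAct ρ) _ hθ.trace_ker _ φ hsurj ?_ e']
    · exact Abelian.Ext.comp_zero _ _ _ _ _
    apply le_antisymm
    · intro y hy
      refine mem_coinvariantsKer_of_untwist_eq_zero hθ y ?_
      rw [← hφ, LinearMap.mem_ker.1 hy, ZeroMemClass.coe_zero]
    · refine Submodule.span_le.2 ?_
      rintro _ ⟨h, y, rfl⟩
      rw [SetLike.mem_coe, LinearMap.mem_ker, map_sub, hinv, sub_self]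

end Ext

end Coinvariants

/-! ### Factorizations in a free EI category -/

namespace Biset

variable {G K L : Type w} [Group G] [Group K] [Group L]

/-- As `K` is a group, the generating relation needs no closure, so equal classes in a biset product
differ by a single element of `K`. -/
theorem rel_equivalence (X : Biset G K) (Y : Biset K L) : Equivalence (Rel X Y) where
  refl p := ⟨1, by simp, by simp⟩
  symm := by
    rintro p q ⟨k, h1, h2⟩
    exact ⟨k⁻¹, by simp [h1], by simp [h2]⟩
  trans := by
    rintro p q r ⟨k, h1, h2⟩ ⟨l, h3, h4⟩
    exact ⟨l * k, by rw [h1, h3, MulOpposite.op_mul, mul_smul], by rw [h4, h2, mul_smul]⟩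

theorem rel_of_pair_eq {X : Biset G K} {Y : Biset K L} {x x' : X.carrier} {y y' : Y.carrier}
    (h : pair X Y x y = pair X Y x' y') : Rel X Y (x, y) (x', y') :=
  (rel_equivalence X Y).eqvGen_iff.1 (Quot.eqvGen_exact h)

end Biset

namespace FiniteEIQuiver

variable {Q : FiniteEIQuiver.{w}}

theorem Mor.length_comp {x y z : Q.V} (f : Q.Mor x y) (g : Q.Mor y z) :
    (Mor.comp Q f g).1.length = f.1.length + g.1.length :=
  Quiver.Path.length_comp _ _

theorem Mor.exists_last {x z : Q.V} (f : Q.Mor x z) {n : ℕ} (hf : f.1.length = n + 1) :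
    ∃ (y : Q.V) (g : Q.Mor x y) (b : Q.Mor y z),
      g.1.length = n ∧ b.1.length = 1 ∧ Mor.comp Q g b = f := by
  obtain ⟨p, h⟩ := f
  cases p with
  | nil => simp at hf
  | cons p a =>
    obtain ⟨b, h⟩ := h
    refine ⟨_, ⟨p, h⟩, Mor.cons Q a b (Mor.id Q _), ?_, rfl, ?_⟩
    · simpa using hf
    · exact congrArg (Mor.cons Q a b) (Mor.comp_id Q ⟨p, h⟩)

theorem Mor.eq_cons_of_length_eq_one {y z : Q.V} (b : Q.Mor y z) (hb : b.1.length = 1) :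
    ∃ (a : y ⟶ z) (b₀ : (Q.biset a).carrier) (g : Q.grp y),
      b = Mor.cons Q a b₀ ⟨Quiver.Path.nil, g⟩ := by
  obtain ⟨p, h⟩ := b
  cases p with
  | nil => simp at hb
  | cons p a =>
    cases p with
    | nil =>
      obtain ⟨b₀, g⟩ := h
      exact ⟨a, b₀, g, rfl⟩
    | cons p a' => simp at hb

theorem Mor.last_unique {x y y' z : Q.V} {f : Q.Mor x y} {b : Q.Mor y z} {f' : Q.Mor x y'}
    {b' : Q.Mor y' z} (hb : b.1.length = 1) (hb' : b'.1.length = 1)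
    (h : Mor.comp Q f b = Mor.comp Q f' b') :
    ∃ e : Q.Mor y y', f' = Mor.comp Q f e ∧ b = Mor.comp Q e b' := by
  obtain ⟨a, b₀, g, rfl⟩ := Mor.eq_cons_of_length_eq_one b hb
  obtain ⟨a', b₀', g', rfl⟩ := Mor.eq_cons_of_length_eq_one b' hb'
  obtain ⟨p, f⟩ := f
  obtain ⟨p', f'⟩ := f'
  change (⟨p.cons a, Biset.pair (Q.biset a) (Q.pathBiset p) b₀ (g • f)⟩ : Q.Mor x z) =
    ⟨p'.cons a', Biset.pair (Q.biset a') (Q.pathBiset p') b₀' (g' • f')⟩ at h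
  obtain ⟨h1, h2⟩ := Sigma.mk.inj h
  obtain ⟨rfl, h3, h4⟩ := Quiver.Path.cons.inj h1
  obtain rfl := eq_of_heq h3
  obtain rfl := eq_of_heq h4
  obtain ⟨k, h5, h6⟩ := Biset.rel_of_pair_eq (eq_of_heq h2)
  simp only at h5 h6
  -- The biset relation reads `b₀ = b₀' · k` and `g' • f' = k • g • f`; solving the latter for `f'`
  -- gives this element.
  refine ⟨⟨Quiver.Path.nil, g'⁻¹ * k * g⟩, ?_, ?_⟩
  · refine congrArg (Sigma.mk p) ?_
    change f' = (g'⁻¹ * k * g) • f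
    rw [mul_smul, mul_smul, ← h6, inv_smul_smul]
  · refine congrArg (Sigma.mk _) (Quot.sound ⟨k, h5, ?_⟩)
    change g' * (g'⁻¹ * k * g) = k * g
    group

end FiniteEIQuiver

/-! ### Length functions and unique factorization -/

/-- A length function on the morphisms of a category with the properties of the length of
morphisms in a free EI category. -/
structure LengthFunction (E : Type u) [Category.{v} E] where
  /-- the length -/
  len : ∀ {x y : E}, (x ⟶ y) → ℕ
  len_comp : ∀ {x y z : E} (f : x ⟶ y) (g : y ⟶ z), len (f ≫ g) = len f + len g
  eq_of_len_eq_zero : ∀ {x y : E} (f : x ⟶ y), len f = 0 → x = y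
  isIso_of_len_eq_zero : ∀ {x y : E} (f : x ⟶ y), len f = 0 → IsIso f
  exists_last : ∀ {x z : E} (f : x ⟶ z) (n : ℕ), len f = n + 1 →
    ∃ (y : E) (g : x ⟶ y) (b : y ⟶ z), len g = n ∧ len b = 1 ∧ g ≫ b = f
  last_unique : ∀ {x y y' z : E} (f : x ⟶ y) (b : y ⟶ z) (f' : x ⟶ y') (b' : y' ⟶ z),
    len b = 1 → len b' = 1 → f ≫ b = f' ≫ b' → ∃ e : y ⟶ y', f' = f ≫ e ∧ b = e ≫ b'

/-- The path length in the generated category is transported along the isomorphism. Freeness enters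
the rest of the argument only through this function. -/
theorem IsFreeEI.nonempty_lengthFunction {E : Type u} [Category.{v} E] [FiniteEICategory E]
    (h : IsFreeEI.{w} E) : Nonempty (LengthFunction E) := by
  obtain ⟨Q, F, _, _, hF⟩ := h
  have heq : ∀ {x y : E} (f : x ⟶ y), (F.map f).1.length = 0 → x = y := by
    intro x y f hf
    have := Quiver.Path.eq_of_length_zero _ hf
    apply hF.1
    cases hx : F.obj x
    cases hy : F.obj y
    simp_all
  refine ⟨⟨fun f => (F.map f).1.length, fun f g => ?_, heq, fun f hf => ?_, fun f n hf => ?_,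
    fun f b f' b' hb hb' hfb => ?_⟩⟩
  · rw [F.map_comp]
    exact FiniteEIQuiver.Mor.length_comp _ _
  · obtain rfl := heq f hf
    exact FiniteEICategory.isIso_end _ f
  · obtain ⟨y, g, b, hg, hb, hgb⟩ := FiniteEIQuiver.Mor.exists_last _ hf
    obtain ⟨y', hy'⟩ := hF.2 ⟨y⟩
    obtain rfl : (F.obj y').vertex = y := by rw [hy']
    obtain ⟨g', rfl⟩ := F.map_surjective (X := _) (Y := y') g
    obtain ⟨b', rfl⟩ := F.map_surjective (X := y') (Y := _) b
    exact ⟨y', g', b', hg, hb, F.map_injective ((F.map_comp _ _).trans hgb)⟩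
  · obtain ⟨e, he, he'⟩ := FiniteEIQuiver.Mor.last_unique (f := F.map f) (f' := F.map f') hb hb'
      ((F.map_comp f b).symm.trans ((congrArg F.map hfb).trans (F.map_comp f' b')))
    obtain ⟨e', rfl⟩ := F.map_surjective e
    exact ⟨e', F.map_injective (he.trans (F.map_comp _ _).symm),
      F.map_injective (he'.trans (F.map_comp _ _).symm)⟩

namespace LengthFunction

variable {E : Type u} [Category.{v} E] (ℓ : LengthFunction E)

theorem len_id (x : E) : ℓ.len (𝟙 x) = 0 := by
  have := ℓ.len_comp (𝟙 x) (𝟙 x)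
  rw [Category.comp_id] at this
  lia

theorem len_eq_zero_iff {x y : E} (f : x ⟶ y) : ℓ.len f = 0 ↔ IsIso f := by
  refine ⟨ℓ.isIso_of_len_eq_zero f, fun h => ?_⟩
  have := ℓ.len_comp f (inv f)
  rw [IsIso.hom_inv_id, len_id] at this
  lia

theorem unfactorizable_iff {x y : E} (f : x ⟶ y) : Unfactorizable f ↔ ℓ.len f = 1 := by
  constructor
  · rintro ⟨h1, h2⟩
    rw [← ℓ.len_eq_zero_iff] at h1
    obtain ⟨n, hn⟩ := Nat.exists_eq_succ_of_ne_zero h1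
    obtain ⟨y, g, b, hg, hb, rfl⟩ := ℓ.exists_last f n hn
    have := h2 y g b rfl
    rw [← ℓ.len_eq_zero_iff, ← ℓ.len_eq_zero_iff] at this
    lia
  · intro h
    refine ⟨?_, ?_⟩
    · rw [← ℓ.len_eq_zero_iff]
      lia
    · rintro y β γ rfl
      rw [ℓ.len_comp] at h
      rw [← ℓ.len_eq_zero_iff, ← ℓ.len_eq_zero_iff]
      lia

theorem hasLength_iff {x y : E} (f : x ⟶ y) (n : ℕ) : HasLength f n ↔ ℓ.len f = n := by
  constructor
  · intro h
    induction h with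
    | iso α h => exact (ℓ.len_eq_zero_iff α).2 h
    | unfactorizable α h => exact (ℓ.unfactorizable_iff α).1 h
    | comp α β n hα hβ ih =>
      rw [ℓ.len_comp, ih, (ℓ.unfactorizable_iff β).1 hβ]
  · intro h
    match n with
    | 0 => exact .iso f (ℓ.isIso_of_len_eq_zero f h)
    | n + 1 =>
      induction n generalizing y with
      | zero => exact .unfactorizable f ((ℓ.unfactorizable_iff f).2 h)
      | succ n ih =>
        obtain ⟨y, g, b, hg, hb, rfl⟩ := ℓ.exists_last f (n + 1) h
        exact .comp g b n (ih g hg) ((ℓ.unfactorizable_iff b).2 hb)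

theorem exists_split {x z : E} (f : x ⟶ z) (m n : ℕ) (h : ℓ.len f = m + n) :
    ∃ (y : E) (g : x ⟶ y) (b : y ⟶ z), ℓ.len g = m ∧ ℓ.len b = n ∧ g ≫ b = f := by
  induction n generalizing z with
  | zero => exact ⟨z, f, 𝟙 z, h, ℓ.len_id z, Category.comp_id f⟩
  | succ n ih =>
    obtain ⟨y, g, b, hg, hb, rfl⟩ := ℓ.exists_last f (m + n) h
    obtain ⟨y', g', b', hg', hb', rfl⟩ := ih g hg
    exact ⟨y', g', b' ≫ b, hg', by rw [ℓ.len_comp, hb', hb], (Category.assoc _ _ _).symm⟩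

/-- Last factors of length one are peeled off in turn. The connecting morphism `d` at each stage has
length zero, so absorbing it into the remaining factor preserves the length. -/
theorem split_unique {x y y' z : E} (f : x ⟶ y) (b : y ⟶ z) (f' : x ⟶ y') (b' : y' ⟶ z)
    (n : ℕ) (hb : ℓ.len b = n) (hb' : ℓ.len b' = n) (h : f ≫ b = f' ≫ b') :
    ∃ e : y ⟶ y', f' = f ≫ e ∧ b = e ≫ b' := by
  induction n generalizing z with
  | zero =>
    have := ℓ.isIso_of_len_eq_zero b' hb'
    refine ⟨b ≫ inv b', ?_, by simp⟩
    rw [← Category.assoc, h, Category.assoc, IsIso.hom_inv_id, Category.comp_id]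
  | succ n ih =>
    obtain ⟨t, g, c, hg, hc, rfl⟩ := ℓ.exists_last b n hb
    obtain ⟨t', g', c', hg', hc', rfl⟩ := ℓ.exists_last b' n hb'
    rw [← Category.assoc, ← Category.assoc] at h
    obtain ⟨d, hd, rfl⟩ := ℓ.last_unique _ c _ c' hc hc' h
    have hd0 : ℓ.len d = 0 := by
      have := ℓ.len_comp d c'
      lia
    obtain ⟨e, rfl, he⟩ := ih (g ≫ d) g' (by rw [ℓ.len_comp, hg, hd0, add_zero]) hg'
      (by rw [hd, Category.assoc])
    exact ⟨e, rfl, by rw [← Category.assoc, he, Category.assoc]⟩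

/-- A factorization of a morphism into an unfactorizable morphism with target `y`, followed by
some morphism, is unique up to an automorphism of `y`. -/
theorem first_unique {x y z : E} {f f' : x ⟶ y} {b b' : y ⟶ z} (hf : ℓ.len f = 1)
    (hf' : ℓ.len f' = 1) (h : f ≫ b = f' ≫ b') : ∃ e : Aut y, f' = f ≫ e.hom ∧ b = e.hom ≫ b' := by
  have h1 := ℓ.len_comp f b
  have h2 := ℓ.len_comp f' b'
  rw [h] at h1
  obtain ⟨e, he, he'⟩ := ℓ.split_unique f b f' b' (ℓ.len b) rfl (by lia) h
  have := ℓ.len_comp f e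
  rw [← he] at this
  have := ℓ.isIso_of_len_eq_zero e (by lia)
  exact ⟨asIso e, he, he'⟩

/-- The connecting morphism has length zero, and such morphisms exist only between equal objects.
Hence the positive part of the algebra splits into blocks indexed by `y`. -/
theorem first_target_unique {x y y' z : E} {f : x ⟶ y} {b : y ⟶ z} {f' : x ⟶ y'} {b' : y' ⟶ z}
    (hf : ℓ.len f = 1) (hf' : ℓ.len f' = 1) (h : f ≫ b = f' ≫ b') : y = y' := by
  have h1 := ℓ.len_comp f b
  have h2 := ℓ.len_comp f' b'
  rw [h] at h1
  obtain ⟨e, he, he'⟩ := ℓ.split_unique f b f' b' (ℓ.len b) rfl (by lia) h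
  have := ℓ.len_comp f e
  rw [← he] at this
  exact ℓ.eq_of_len_eq_zero e (by lia)

end LengthFunction

/-! ### The length grading of the category algebra -/

namespace CategoryAlgebra

variable {k : Type t} [Field k] {E : Type u} [Category.{v} E]

variable (k) in
/-- The coefficient of a morphism in an element of the category algebra. -/
def coeff (m : TotalHom E) : CategoryAlgebra k E →ₗ[k] k :=
  (Finsupp.lapply m : (TotalHom E →₀ k) →ₗ[k] k)

open Classical in
theorem coeff_of (m m' : TotalHom E) : coeff k m (of k m') = if m' = m then 1 else 0 :=
  Finsupp.single_apply

theorem coeff_ext {a b : CategoryAlgebra k E} (h : ∀ m, coeff k m a = coeff k m b) : a = b :=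
  Finsupp.ext h

/-- The subspace spanned by a set of morphisms consists of the elements supported there. -/
theorem mem_span_of_iff (s : Set (TotalHom E)) (a : CategoryAlgebra k E) :
    a ∈ Submodule.span k (of k '' s) ↔ ∀ m ∉ s, coeff k m a = 0 := by
  have h : Finsupp.supported k k s = Submodule.span k ((fun m => Finsupp.single m 1) '' s) :=
    Finsupp.supported_eq_span_single k s
  have h' : a ∈ Submodule.span k (of k '' s) ↔ a ∈ Finsupp.supported k k s := by
    rw [h]; rfl
  exact h'.trans (Finsupp.mem_supported' _ _)

variable [FiniteEICategory E]

theorem of_mul_of (β α : TotalHom E) : of k β * of k α = mulHom k β α :=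
  mulLin_of k β α

theorem of_mul_of_comp {x y z : E} (α : x ⟶ y) (β : y ⟶ z) :
    of k ⟨y, z, β⟩ * of k ⟨x, y, α⟩ = of k ⟨x, z, α ≫ β⟩ := by
  simp [of_mul_of, mulHom]

theorem of_mul_of_ne {β α : TotalHom E} (h : α.tgt ≠ β.src) : of k β * of k α = 0 := by
  simp [of_mul_of, mulHom, h]

variable (ℓ : LengthFunction E)

include ℓ in
theorem of_mem_lengthGrading (m : TotalHom E) : of k m ∈ lengthGrading k E (ℓ.len m.hom) :=
  Submodule.subset_span ⟨m, (ℓ.hasLength_iff _ _).2 rfl, rfl⟩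

/-- The length grading as a decomposition of the category algebra. -/
def lengthDecompose : CategoryAlgebra k E →ₗ[k] DirectSum ℕ fun n => lengthGrading k E n :=
  lift k fun m => DirectSum.lof k ℕ (fun n => lengthGrading k E n) (ℓ.len m.hom)
    ⟨of k m, of_mem_lengthGrading ℓ m⟩

theorem lengthDecompose_of {m : TotalHom E} {n : ℕ} (h : of k m ∈ lengthGrading k E n)
    (hn : ℓ.len m.hom = n) : lengthDecompose ℓ (of k m) =
      DirectSum.lof k ℕ (fun n => lengthGrading k E n) n ⟨of k m, h⟩ := by
  subst hn
  exact lift_of k _ _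

theorem lengthDecompose_coe {n : ℕ} {a : CategoryAlgebra k E} (ha : a ∈ lengthGrading k E n) :
    lengthDecompose ℓ a = DirectSum.lof k ℕ (fun n => lengthGrading k E n) n ⟨a, ha⟩ := by
  unfold lengthGrading at ha
  induction ha using Submodule.span_induction with
  | mem a h =>
    obtain ⟨m, hm, rfl⟩ := h
    exact lengthDecompose_of ℓ _ ((ℓ.hasLength_iff _ _).1 hm)
  | zero => rw [map_zero]; exact (map_zero _).symm
  | add a b ha hb iha ihb =>
    rw [map_add, iha, ihb, ← map_add]; rfl
  | smul c a ha ih => rw [map_smul, ih, ← map_smul]; rfl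

/-- The category algebra of a free EI category is graded by the length of morphisms. -/
@[reducible]
def gradedAlgebra : GradedAlgebra (lengthGrading k E) :=
  { DirectSum.Decomposition.ofLinearMap (lengthGrading k E) (lengthDecompose ℓ)
      (hom_ext fun m => by
        simp only [LinearMap.comp_apply, LinearMap.id_apply]
        rw [lengthDecompose_of ℓ (of_mem_lengthGrading ℓ m) rfl, DirectSum.coeLinearMap_lof])
      (DirectSum.linearMap_ext _ fun n => LinearMap.ext fun a => by
        simp only [LinearMap.comp_apply, LinearMap.id_apply]
        rw [DirectSum.coeLinearMap_lof, lengthDecompose_coe ℓ a.2]) with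
    one_mem := by
      have : Finite E := FiniteEICategory.finite_obj E
      change unit k E ∈ _
      have := Fintype.ofFinite E
      rw [unit, finsum_eq_sum_of_fintype]
      refine Submodule.sum_mem _ fun x _ => ?_
      have := of_mem_lengthGrading (k := k) ℓ ⟨x, x, 𝟙 x⟩
      rwa [ℓ.len_id] at this
    mul_mem := by
      intro i j a b ha hb
      unfold lengthGrading at ha hb
      induction ha using Submodule.span_induction with
      | zero => rw [zero_mul]; exact Submodule.zero_mem _
      | add a a' _ _ iha ihb => rw [add_mul]; exact Submodule.add_mem _ iha ihb
      | smul c a _ ih => rw [smul_mul_assoc]; exact Submodule.smul_mem _ _ ih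
      | mem a h =>
        obtain ⟨⟨y', z, β⟩, hβ, rfl⟩ := h
        induction hb using Submodule.span_induction with
        | zero => rw [mul_zero]; exact Submodule.zero_mem _
        | add a a' _ _ iha ihb => rw [mul_add]; exact Submodule.add_mem _ iha ihb
        | smul c a _ ih => rw [mul_smul_comm]; exact Submodule.smul_mem _ _ ih
        | mem a h =>
          obtain ⟨⟨x, y, α⟩, hα, rfl⟩ := h
          by_cases h : y = y'
          · subst h
            rw [of_mul_of_comp]
            have := of_mem_lengthGrading (k := k) ℓ ⟨x, z, α ≫ β⟩
            rwa [ℓ.len_comp, (ℓ.hasLength_iff _ _).1 hα, (ℓ.hasLength_iff _ _).1 hβ,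
              add_comm] at this
          · rw [of_mul_of_ne h]
            exact Submodule.zero_mem _ }

/-- The ideal spanned by the morphisms of positive length. -/
def posIdeal (k : Type t) [Field k] : Ideal (CategoryAlgebra k E) :=
  letI := gradedAlgebra (k := k) ℓ
  (HomogeneousIdeal.irrelevant (lengthGrading k E)).toIdeal

open Classical in
theorem coeff_lengthDecompose (m : TotalHom E) (n : ℕ) (a : CategoryAlgebra k E) :
    coeff k m (lengthDecompose ℓ a n) = if ℓ.len m.hom = n then coeff k m a else 0 := by
  let f : CategoryAlgebra k E →ₗ[k] k := coeff k m ∘ₗ (lengthGrading k E n).subtype ∘ₗ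
    DirectSum.component k ℕ (fun n => lengthGrading k E n) n ∘ₗ lengthDecompose ℓ
  have : f = if ℓ.len m.hom = n then coeff k m else 0 := by
    refine hom_ext fun m' => ?_
    simp only [f, LinearMap.comp_apply]
    rw [lengthDecompose_of ℓ (of_mem_lengthGrading ℓ m') rfl]
    by_cases h : ℓ.len m'.hom = n
    · subst h
      rw [DirectSum.component.lof_self]
      by_cases h : m' = m
      · subst h; simp
      · split_ifs <;> simp [coeff_of, h]
    · rw [DirectSum.component.of, dif_neg h]
      by_cases h' : m' = m
      · subst h'; simp [h]
      · split_ifs <;> simp [coeff_of, h']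
  have := LinearMap.congr_fun this a
  refine Eq.trans ?_ (this.trans ?_)
  · rfl
  · split_ifs <;> rfl

theorem mem_posIdeal_iff (a : CategoryAlgebra k E) :
    a ∈ posIdeal ℓ k ↔ ∀ m : TotalHom E, ℓ.len m.hom = 0 → coeff k m a = 0 := by
  let := gradedAlgebra (k := k) ℓ
  have h : a ∈ posIdeal ℓ k ↔ (lengthDecompose ℓ a 0 : CategoryAlgebra k E) = 0 :=
    HomogeneousIdeal.mem_irrelevant_iff _ _
  rw [h]
  constructor
  · intro h m hm
    have := coeff_lengthDecompose ℓ m 0 a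
    rwa [h, if_pos hm, map_zero, eq_comm] at this
  · intro h
    refine coeff_ext fun m => ?_
    rw [coeff_lengthDecompose, map_zero]
    split_ifs with hm
    · exact h m hm
    · rfl

theorem mem_span_of_mem_posIdeal {a : CategoryAlgebra k E} (ha : a ∈ posIdeal ℓ k) :
    a ∈ Submodule.span k (of k '' {m : TotalHom E | ℓ.len m.hom ≠ 0}) := by
  rw [mem_span_of_iff]
  intro m hm
  exact (mem_posIdeal_iff ℓ a).1 ha m (by simpa using hm)

theorem of_mem_posIdeal {m : TotalHom E} (hm : ℓ.len m.hom ≠ 0) : of k m ∈ posIdeal ℓ k := by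
  rw [mem_posIdeal_iff]
  intro m' hm'
  rw [coeff_of, if_neg]
  rintro rfl
  exact hm hm'

theorem smul_mem_posIdeal (c : k) {a : CategoryAlgebra k E} (ha : a ∈ posIdeal ℓ k) :
    c • a ∈ posIdeal ℓ k := by
  rw [← one_mul a, ← smul_mul_assoc]
  exact Ideal.mul_mem_left _ _ ha

@[elab_as_elim]
theorem induction_of {p : CategoryAlgebra k E → Prop} (of : ∀ m : TotalHom E, p (of k m))
    (zero : p 0) (add : ∀ a b, p a → p b → p (a + b)) (smul : ∀ (c : k) a, p a → p (c • a))
    (a : CategoryAlgebra k E) : p a := by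
  have : a ∈ Submodule.span k (CategoryAlgebra.of k '' Set.univ) := by
    rw [mem_span_of_iff]
    exact fun m hm => (hm trivial).elim
  induction this using Submodule.span_induction with
  | mem a h => obtain ⟨m, hm, rfl⟩ := h; exact of m
  | zero => exact zero
  | add a b _ _ iha ihb => exact add a b iha ihb
  | smul c a _ ih => exact smul c a ih

/-- An `Ideal` is only a left ideal here; closure under right multiplication is needed for the ideal
to annihilate the quotient by it. -/
theorem posIdeal_mul_mem {a : CategoryAlgebra k E} (ha : a ∈ posIdeal ℓ k)
    (b : CategoryAlgebra k E) : a * b ∈ posIdeal ℓ k := by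
  replace ha := mem_span_of_mem_posIdeal ℓ ha
  induction ha using Submodule.span_induction with
  | zero => rw [zero_mul]; exact Submodule.zero_mem _
  | add a a' _ _ iha ihb => rw [add_mul]; exact Submodule.add_mem _ iha ihb
  | smul c a _ ih => rw [smul_mul_assoc]; exact smul_mem_posIdeal ℓ c ih
  | mem a h =>
    obtain ⟨m, hm, rfl⟩ := h
    induction b using induction_of with
    | zero => rw [mul_zero]; exact Submodule.zero_mem _
    | add a a' iha ihb => rw [mul_add]; exact Submodule.add_mem _ iha ihb
    | smul c a ih => rw [mul_smul_comm]; exact smul_mem_posIdeal ℓ c ih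
    | of m' =>
      obtain ⟨y', z, β⟩ := m
      obtain ⟨x, y, α⟩ := m'
      by_cases h : y = y'
      · subst h
        rw [of_mul_of_comp]
        refine of_mem_posIdeal ℓ ?_
        rw [ℓ.len_comp]
        exact fun h => hm (Nat.add_eq_zero_iff.1 h).2
      · rw [of_mul_of_ne h]
        exact Submodule.zero_mem _

/-! ### The trace form on the degree zero part -/

/-- The inverse of a morphism of length zero. -/
def symm (m : TotalHom E) (hm : ℓ.len m.hom = 0) : TotalHom E :=
  have := ℓ.isIso_of_len_eq_zero m.hom hm
  ⟨m.tgt, m.src, inv m.hom⟩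

theorem len_symm (m : TotalHom E) (hm : ℓ.len m.hom = 0) : ℓ.len (symm ℓ m hm).hom = 0 := by
  have := ℓ.isIso_of_len_eq_zero m.hom hm
  rw [ℓ.len_eq_zero_iff]
  change IsIso (inv m.hom)
  infer_instance

theorem symm_symm (m : TotalHom E) (hm : ℓ.len m.hom = 0) :
    symm ℓ (symm ℓ m hm) (len_symm ℓ m hm) = m := by
  have := ℓ.isIso_of_len_eq_zero m.hom hm
  simp [symm]

open Classical in
variable (k E) in
/-- The sum of the coefficients of the identities. -/
def traceForm : CategoryAlgebra k E →ₗ[k] k :=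
  lift k fun m => if ∃ x, m = ⟨x, x, 𝟙 x⟩ then 1 else 0

open Classical in
theorem traceForm_of (m : TotalHom E) :
    traceForm k E (of k m) = if ∃ x, m = ⟨x, x, 𝟙 x⟩ then 1 else 0 :=
  lift_of k _ _

/-- A composite of some `m'` with the inverse of `m` is an identity exactly when `m' = m`. So the
morphisms of length zero and their inverses are dual bases for the trace form, and the degree zero
part is a Frobenius algebra. -/
theorem traceForm_symm_mul (m : TotalHom E) (hm : ℓ.len m.hom = 0) (a : CategoryAlgebra k E) :
    traceForm k E (of k (symm ℓ m hm) * a) = coeff k m a := by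
  classical
  have := ℓ.isIso_of_len_eq_zero m.hom hm
  induction a using induction_of with
  | zero => rw [mul_zero, map_zero, map_zero]
  | add a a' iha ihb => rw [mul_add, map_add, map_add, iha, ihb]
  | smul c a ih => rw [mul_smul_comm, map_smul, map_smul, ih]
  | of m' =>
    rw [coeff_of]
    obtain ⟨x, y, α⟩ := m
    obtain ⟨x', y', α'⟩ := m'
    simp only at this
    simp only [symm]
    by_cases h : y' = y
    · subst h
      rw [of_mul_of_comp, traceForm_of]
      congr 1
      refine propext ⟨?_, ?_⟩
      · rintro ⟨z, hz⟩
        obtain ⟨rfl, h⟩ := TotalHom.mk.inj hz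
        obtain ⟨rfl, h⟩ := h
        rw [← (IsIso.comp_inv_eq _).1 (eq_of_heq h) |>.trans (Category.id_comp α)]
      · intro h
        obtain ⟨rfl, h⟩ := TotalHom.mk.inj h
        obtain rfl := eq_of_heq h.2
        exact ⟨x', by simp⟩
    · rw [of_mul_of_ne h, map_zero, if_neg]
      rintro h'
      exact h (TotalHom.mk.inj h').2.1

theorem traceForm_eq_zero {a : CategoryAlgebra k E} (ha : a ∈ posIdeal ℓ k) :
    traceForm k E a = 0 := by
  replace ha := mem_span_of_mem_posIdeal ℓ ha
  induction ha using Submodule.span_induction with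
  | zero => exact map_zero _
  | add a a' _ _ iha ihb => rw [map_add, iha, ihb, add_zero]
  | smul c a _ ih => rw [map_smul, ih, smul_zero]
  | mem a h =>
    obtain ⟨m, hm, rfl⟩ := h
    rw [traceForm_of, if_neg]
    rintro ⟨x, rfl⟩
    exact hm (ℓ.len_id x)

variable (k) in
/-- The form induced by the trace form on the quotient by the morphisms of positive length. -/
def quotientTrace : (CategoryAlgebra k E ⧸ posIdeal ℓ k) →ₗ[k] k :=
  ((posIdeal ℓ k).restrictScalars k).liftQ (traceForm k E) (fun _ ha => traceForm_eq_zero ℓ ha) ∘ₗ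
    (Submodule.Quotient.restrictScalarsEquiv k (posIdeal ℓ k)).symm.toLinearMap

theorem quotientTrace_mk (a : CategoryAlgebra k E) :
    quotientTrace k ℓ (Submodule.Quotient.mk a) = traceForm k E a := rfl

theorem isDualOfQuotient : IsDualOfQuotient (posIdeal ℓ k) (quotientTrace k ℓ) where
  smul_eq_zero j hj s := by
    obtain ⟨a, rfl⟩ := Submodule.Quotient.mk_surjective _ s
    rw [← Submodule.Quotient.mk_smul, Submodule.Quotient.mk_eq_zero]
    exact posIdeal_mul_mem ℓ hj a
  eq_zero s hs := by
    obtain ⟨a, rfl⟩ := Submodule.Quotient.mk_surjective _ s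
    rw [Submodule.Quotient.mk_eq_zero, mem_posIdeal_iff]
    intro m hm
    rw [← traceForm_symm_mul ℓ m hm]
    exact hs _
  exists_repr φ hφ := by
    classical
    have := FiniteEICategory.finite_hom (E := E)
    have := Fintype.ofFinite (TotalHom E)
    -- The expansion of `φ` in the dual basis: the coefficient at `m` is the value of `φ` at the
    -- inverse of `m`.
    let s : CategoryAlgebra k E := ∑ m : TotalHom E,
      if hm : ℓ.len m.hom = 0 then φ (of k (symm ℓ m hm)) • of k m else 0
    refine ⟨Submodule.Quotient.mk s, fun a => ?_⟩
    rw [← Submodule.Quotient.mk_smul, quotientTrace_mk, smul_eq_mul]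
    induction a using induction_of with
    | zero => rw [zero_mul, map_zero, map_zero]
    | add a a' iha ihb => rw [add_mul, map_add, map_add, iha, ihb]
    | smul c a ih => rw [smul_mul_assoc, map_smul, map_smul, ih]
    | of m =>
      by_cases hm : ℓ.len m.hom = 0
      · have h1 := traceForm_symm_mul ℓ _ (len_symm ℓ m hm) s
        rw [symm_symm] at h1
        rw [h1]
        simp only [s, map_sum]
        rw [Finset.sum_eq_single (symm ℓ m hm)]
        · rw [dif_pos (len_symm ℓ m hm), map_smul, symm_symm, coeff_of]
          simp
        · intro m' _ hm'
          split_ifs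
          · rw [map_smul, coeff_of, if_neg hm', smul_zero]
          · exact map_zero _
        · simp
      · rw [hφ _ (of_mem_posIdeal ℓ hm)]
        exact traceForm_eq_zero ℓ (posIdeal_mul_mem ℓ (of_mem_posIdeal ℓ hm) s)

end CategoryAlgebra

/-! ### Weights on orbits and the module of pairs -/

/-- If a finite group acts with stabilizers of invertible order, then there is a weight whose sum
over every orbit, parametrized by the group, is one. -/
theorem exists_weight {k : Type*} [Field k] {G Ω : Type*} [Group G] [Fintype G] [MulAction G Ω]
    (h : ∀ ω : Ω, IsUnit (Nat.card (MulAction.stabilizer G ω) : k)) :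
    ∃ c : Ω → k, ∀ ω, ∑ g : G, c (g⁻¹ • ω) = 1 := by
  classical
  let rep : Ω → Ω := fun ω => (Quotient.mk (MulAction.orbitRel G Ω) ω).out
  have hrep : ∀ ω, ∃ g : G, g • ω = rep ω := fun ω =>
    (MulAction.orbitRel_apply.1 (Quotient.exact (s := MulAction.orbitRel G Ω)
      (Quotient.out_eq (Quotient.mk (MulAction.orbitRel G Ω) ω))))
  have hinv : ∀ (g : G) ω, rep (g • ω) = rep ω := fun g ω =>
    congrArg Quotient.out (Quotient.sound (s := MulAction.orbitRel G Ω) ⟨g, rfl⟩)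
  -- The weight is concentrated on one representative per orbit. The group elements that carry `ω`
  -- to it form a coset of a stabilizer, whose order cancels the weight.
  refine ⟨fun ω => if ω = rep ω then (Nat.card (MulAction.stabilizer G ω) : k)⁻¹ else 0,
    fun ω => ?_⟩
  obtain ⟨g₀, hg₀⟩ := hrep ω
  have hω : rep (rep ω) = rep ω := by rw [← hg₀, hinv, hg₀]
  rw [← Equiv.sum_comp (Equiv.inv G), ← Equiv.sum_comp (Equiv.mulRight g₀)]
  have : ∀ g : G, (Equiv.inv G (Equiv.mulRight g₀ g))⁻¹ • ω = g • rep ω := fun g => by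
    simp [mul_smul, hg₀]
  simp only [this, hinv, hω]
  rw [Finset.sum_congr rfl fun g _ => show (if g • rep ω = rep ω then
      (Nat.card (MulAction.stabilizer G (g • rep ω)) : k)⁻¹ else 0) =
      if g • rep ω = rep ω then (Nat.card (MulAction.stabilizer G (rep ω)) : k)⁻¹ else 0 by
    split_ifs with hg
    · rw [hg]
    · rfl]
  rw [← Finset.sum_filter, Finset.sum_const, nsmul_eq_mul]
  have hcard : Nat.card (MulAction.stabilizer G (rep ω)) =
      (Finset.univ.filter fun g : G => g • rep ω = rep ω).card :=
    Nat.subtype_card _ fun g => by simp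
  rw [← hcard]
  exact mul_inv_cancel₀ (h _).ne_zero

namespace CategoryAlgebra

variable {k : Type t} [Field k] {E : Type u} [Category.{v} E]

variable (k) in
/-- The basis element of an automorphism. -/
def ofAut {y : E} (g : Aut y) : CategoryAlgebra k E :=
  of k ⟨y, y, g.hom⟩

/-- Multiplication of the coefficients by given weights. -/
def scale (c : TotalHom E → k) : CategoryAlgebra k E →ₗ[k] CategoryAlgebra k E :=
  lift k fun m => c m • of k m

variable [FiniteEICategory E]

theorem coeff_scale (c : TotalHom E → k) (m : TotalHom E) (a : CategoryAlgebra k E) :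
    coeff k m (scale c a) = c m * coeff k m a := by
  have : coeff k m ∘ₗ scale c = c m • coeff k m := by
    classical
    refine hom_ext fun m' => ?_
    rw [LinearMap.comp_apply, scale, lift_of, map_smul, LinearMap.smul_apply, coeff_of]
    split_ifs with h
    · rw [h]
    · simp
  exact LinearMap.congr_fun this a

theorem ofAut_mul {y : E} (g h : Aut y) : ofAut k (g * h) = ofAut k g * ofAut k h :=
  (of_mul_of_comp _ _).symm

theorem of_mul_ofAut {y z : E} (β : y ⟶ z) (g : Aut y) :
    of k ⟨y, z, β⟩ * ofAut k g = of k ⟨y, z, g.hom ≫ β⟩ :=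
  of_mul_of_comp _ _

theorem coeff_mul_ofAut {y z : E} (α : y ⟶ z) (g : Aut y) (a : CategoryAlgebra k E) :
    coeff k ⟨y, z, α⟩ (a * ofAut k g) = coeff k ⟨y, z, g.inv ≫ α⟩ a := by
  classical
  induction a using induction_of with
  | zero => rw [zero_mul, map_zero, map_zero]
  | add a a' iha ihb => rw [add_mul, map_add, map_add, iha, ihb]
  | smul c a ih => rw [smul_mul_assoc, map_smul, map_smul, ih]
  | of m =>
    obtain ⟨y', z', β⟩ := m
    by_cases h : y = y'
    · subst h
      rw [of_mul_ofAut, coeff_of, coeff_of]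
      congr 1
      simp only [TotalHom.mk.injEq, true_and, eq_iff_iff]
      refine and_congr_right ?_
      rintro rfl
      rw [heq_iff_eq, heq_iff_eq]
      exact (Iso.eq_inv_comp (g : y ≅ y)).symm
    · rw [ofAut, of_mul_of_ne h, map_zero, coeff_of, if_neg]
      intro h'
      exact h (TotalHom.mk.inj h').1.symm

theorem coeff_mul_ofAut_of_ne {y : E} {m : TotalHom E} (hm : m.src ≠ y) (g : Aut y)
    (a : CategoryAlgebra k E) : coeff k m (a * ofAut k g) = 0 := by
  classical
  induction a using induction_of with
  | zero => rw [zero_mul, map_zero]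
  | add a a' iha ihb => rw [add_mul, map_add, iha, ihb, add_zero]
  | smul c a ih => rw [smul_mul_assoc, map_smul, ih, smul_zero]
  | of m' =>
    obtain ⟨y', z', β⟩ := m'
    by_cases h : y = y'
    · subst h
      rw [of_mul_ofAut, coeff_of, if_neg]
      rintro rfl
      exact hm rfl
    · rw [ofAut, of_mul_of_ne h, map_zero]

theorem mul_ofAut_one_eq_iff {y : E} (a : CategoryAlgebra k E) :
    a * ofAut k (1 : Aut y) = a ↔ ∀ m : TotalHom E, m.src ≠ y → coeff k m a = 0 := by
  constructor
  · intro h m hm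
    rw [← h, coeff_mul_ofAut_of_ne hm]
  · intro h
    refine coeff_ext fun m => ?_
    by_cases hm : m.src = y
    · subst hm
      refine (coeff_mul_ofAut m.hom 1 a).trans ?_
      congr 2
      exact congrArg (TotalHom.mk m.src m.tgt) (Category.id_comp m.hom)
    · rw [coeff_mul_ofAut_of_ne hm, h m hm]

variable (ℓ : LengthFunction E) (y : E)

/-- The unfactorizable morphisms with target `y`. -/
def Last (y : E) := Σ x : E, {f : x ⟶ y // ℓ.len f = 1}

instance : Finite (Last ℓ y) := by
  have := FiniteEICategory.finite_hom (E := E)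
  refine Finite.of_injective (fun f : Last ℓ y => (⟨f.1, y, f.2.1⟩ : TotalHom E)) ?_
  rintro ⟨x, f, hf⟩ ⟨x', f', hf'⟩ h
  obtain ⟨rfl, h⟩ := TotalHom.mk.inj h
  obtain rfl := eq_of_heq h.2
  rfl

instance : Fintype (Last ℓ y) := Fintype.ofFinite _

instance : Finite (Aut y) := by
  have := FiniteEICategory.finite_hom (E := E)
  refine Finite.of_injective (fun f : Aut y => (⟨y, y, f.hom⟩ : TotalHom E)) ?_
  intro f g h
  exact Iso.ext (eq_of_heq (TotalHom.mk.inj h).2.2)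

instance : MulAction (Aut y) (Last ℓ y) where
  smul g f := ⟨f.1, f.2.1 ≫ g.hom, by
    rw [ℓ.len_comp, f.2.2, (ℓ.len_eq_zero_iff g.hom).2 (Iso.isIso_hom (g : y ≅ y))]⟩
  one_smul f := Sigma.ext rfl (heq_of_eq (Subtype.ext (Category.comp_id _)))
  mul_smul g h f := Sigma.ext rfl (heq_of_eq (Subtype.ext (Category.assoc _ _ _).symm))

/-- The morphisms with source `y`. -/
def HomFrom (y : E) := Σ z : E, y ⟶ z

/-- Precomposing with the inverse makes the diagonal action on pairs preserve the composite: `(f ≫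
g) ≫ (g⁻¹ ≫ b) = f ≫ b`. -/
instance : MulAction (Aut y) (HomFrom y) where
  smul g f := ⟨f.1, g.inv ≫ f.2⟩
  one_smul _ := Sigma.ext rfl (heq_of_eq (Category.id_comp _))
  mul_smul _ _ _ := Sigma.ext rfl (heq_of_eq (Category.assoc _ _ _))

/-- The stabilizer of a pair lies in the stabilizers of both entries, so its order divides both of
theirs and either kind of regularity suffices. -/
theorem isUnit_card_stabilizer {y : E} (hy : IsLeftRegularObj k y ∨ IsRightRegularObj k y)
    (p : Last ℓ y × HomFrom y) : IsUnit (Nat.card (MulAction.stabilizer (Aut y) p) : k) := by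
  obtain ⟨⟨x, f, hf⟩, ⟨z, b⟩⟩ := p
  rcases hy with hy | hy
  · refine isUnit_of_dvd_unit (Nat.cast_dvd_cast (Subgroup.card_dvd_of_le ?_)) (hy x f)
    intro g hg
    have h1 := congrArg Prod.fst (MulAction.mem_stabilizer_iff.1 hg)
    exact congrArg Subtype.val (eq_of_heq (Sigma.mk.inj h1).2)
  · refine isUnit_of_dvd_unit (Nat.cast_dvd_cast (Subgroup.card_dvd_of_le ?_)) (hy z b)
    intro g hg
    have h1 := congrArg Prod.snd (MulAction.mem_stabilizer_iff.1 hg)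
    have h2 : g.inv ≫ b = b := eq_of_heq (Sigma.mk.inj h1).2
    exact ((Iso.inv_comp_eq _).1 h2).symm

/-- The functions `f` on the unfactorizable morphisms with target `y`, with values in the part of
the category algebra spanned by the morphisms with source `y`. This is the free module with basis
the pairs of an unfactorizable morphism to `y` and a morphism from `y`. -/
def pairModule (k : Type t) [Field k] : Submodule (CategoryAlgebra k E)
    (Last ℓ y → CategoryAlgebra k E) where
  carrier := {f | ∀ u, f u * ofAut k (1 : Aut y) = f u}
  zero_mem' u := zero_mul _
  add_mem' hf hg u := by
    rw [Pi.add_apply, add_mul, hf, hg]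
  smul_mem' a f hf u := by
    rw [Pi.smul_apply, smul_eq_mul, mul_assoc, hf]

theorem projective_pairModule :
    Module.Projective (CategoryAlgebra k E) (pairModule ℓ y k) := by
  refine Module.Projective.of_split (pairModule ℓ y k).subtype
    (LinearMap.codRestrict _ (LinearMap.pi fun u => LinearMap.toSpanSingleton _ _
      (ofAut k (1 : Aut y)) ∘ₗ LinearMap.proj u) fun f u => ?_) ?_
  · change f u * _ * _ = f u * _
    rw [mul_assoc, ← ofAut_mul, one_mul]
  · ext1 f
    exact Subtype.ext (funext f.2)

/-- The action of `Aut y` on `pairModule`. -/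
def pairAct : Aut y →* Module.End (CategoryAlgebra k E) (pairModule ℓ y k) where
  toFun g := LinearMap.codRestrict _ (LinearMap.pi fun u => LinearMap.toSpanSingleton _ _
      (ofAut k g⁻¹) ∘ₗ LinearMap.proj (g⁻¹ • u) ∘ₗ (pairModule ℓ y k).subtype) fun f u => by
    change f.1 _ * _ * _ = f.1 _ * _
    rw [mul_assoc, ← ofAut_mul, mul_one]
  map_one' := by
    ext1 f
    refine Subtype.ext (funext fun u => ?_)
    change f.1 _ * _ = f.1 u
    rw [inv_one, one_smul]
    exact f.2 u
  map_mul' g h := by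
    ext1 f
    refine Subtype.ext (funext fun u => ?_)
    change f.1 _ * _ = f.1 _ * _ * _
    rw [mul_inv_rev, mul_smul, mul_assoc, ← ofAut_mul]

theorem pairAct_coe (g : Aut y) (f : pairModule ℓ y k) (u : Last ℓ y) :
    (pairAct ℓ y g f).1 u = f.1 (g⁻¹ • u) * ofAut k g⁻¹ := rfl

variable {y}

open Classical in
/-- The basis element of `pairModule` of a pair. -/
def pairBasis (k : Type t) [Field k] (p : Last ℓ y × HomFrom y) : pairModule ℓ y k :=
  ⟨Pi.single p.1 (of k ⟨y, p.2.1, p.2.2⟩), fun u => by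
    by_cases h : u = p.1
    · subst h
      rw [Pi.single_eq_same, of_mul_ofAut]
      congr 2
      exact Category.id_comp _
    · rw [Pi.single_eq_of_ne h, zero_mul]⟩

open Classical in
theorem pairBasis_coe (p : Last ℓ y × HomFrom y) :
    (pairBasis ℓ k p).1 = Pi.single p.1 (of k ⟨y, p.2.1, p.2.2⟩) := rfl

theorem pairAct_pairBasis (g : Aut y) (p : Last ℓ y × HomFrom y) :
    pairAct ℓ y g (pairBasis ℓ k p) = pairBasis ℓ k (g • p) := by
  classical
  refine Subtype.ext (funext fun u => ?_)
  rw [pairAct_coe, pairBasis_coe, pairBasis_coe]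
  by_cases h : u = g • p.1
  · subst h
    rw [inv_smul_smul, Pi.single_eq_same, of_mul_ofAut]
    exact (Pi.single_eq_same (M := fun _ => CategoryAlgebra k E) _ _).symm
  · rw [Pi.single_eq_of_ne, zero_mul]
    · exact (Pi.single_eq_of_ne (M := fun _ => CategoryAlgebra k E) h _).symm
    · rintro h'
      exact h (inv_smul_eq_iff.1 h')

/-- The composite of a pair. -/
def pairComp (p : Last ℓ y × HomFrom y) : TotalHom E :=
  ⟨p.1.1, p.2.1, p.1.2.1 ≫ p.2.2⟩

/-- Unique factorization in terms of the action: pairs through `y` with the same composite form one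
orbit, so passing to coinvariants leaves one class per composite. -/
theorem exists_smul_of_pairComp_eq {p q : Last ℓ y × HomFrom y}
    (h : pairComp ℓ p = pairComp ℓ q) : ∃ g : Aut y, q = g • p := by
  obtain ⟨⟨x, f, hf⟩, ⟨z, b⟩⟩ := p
  obtain ⟨⟨x', f', hf'⟩, ⟨z', b'⟩⟩ := q
  obtain ⟨h1, h2⟩ := TotalHom.mk.inj h
  simp only at h1
  subst h1
  obtain ⟨h2, h3⟩ := h2
  simp only at h2
  subst h2
  obtain ⟨e, rfl, he⟩ := ℓ.first_unique hf hf' (eq_of_heq h3)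
  change b = e.hom ≫ b' at he
  subst he
  refine ⟨e, Prod.ext rfl (Sigma.ext rfl (heq_of_eq ?_))⟩
  exact (Iso.inv_hom_id_assoc e b').symm

theorem eq_of_pairComp_eq {y' : E} {p : Last ℓ y × HomFrom y} {q : Last ℓ y' × HomFrom y'}
    (h : pairComp ℓ p = pairComp ℓ q) : y = y' := by
  obtain ⟨⟨x, f, hf⟩, ⟨z, b⟩⟩ := p
  obtain ⟨⟨x', f', hf'⟩, ⟨z', b'⟩⟩ := q
  obtain ⟨h1, h2⟩ := TotalHom.mk.inj h
  simp only at h1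
  subst h1
  obtain ⟨h2, h3⟩ := h2
  simp only at h2
  subst h2
  exact ℓ.first_target_unique hf hf' (eq_of_heq h3)

theorem exists_pairComp_eq {m : TotalHom E} (hm : ℓ.len m.hom ≠ 0) :
    ∃ (y : E) (p : Last ℓ y × HomFrom y), m = pairComp ℓ p := by
  obtain ⟨n, hn⟩ := Nat.exists_eq_succ_of_ne_zero hm
  obtain ⟨y, f, b, hf, hb, h⟩ := ℓ.exists_split m.hom 1 n (by lia)
  refine ⟨y, ⟨⟨m.src, f, hf⟩, ⟨m.tgt, b⟩⟩, ?_⟩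
  rw [pairComp, h]

/-! ### The endomorphism of trace one -/

/-- The value at a morphism with source `y` of a function on such morphisms, extended by zero. -/
def extendWeight (c : HomFrom y → k) (m : TotalHom E) : k :=
  open Classical in
  if h : m.src = y then c ⟨m.tgt, eqToHom h.symm ≫ m.hom⟩ else 0

theorem extendWeight_mk (c : HomFrom y → k) {z : E} (b : y ⟶ z) :
    extendWeight c ⟨y, z, b⟩ = c ⟨z, b⟩ := by
  simp [extendWeight]

/-- Multiplication of the coefficients by given weights, on `pairModule`. -/
def pairScale (c : Last ℓ y × HomFrom y → k) : pairModule ℓ y k →ₗ[k] pairModule ℓ y k where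
  toFun f := ⟨fun u => scale (extendWeight fun b => c (u, b)) (f.1 u), fun u => by
    rw [mul_ofAut_one_eq_iff]
    intro m hm
    rw [coeff_scale, (mul_ofAut_one_eq_iff _).1 (f.2 u) m hm, mul_zero]⟩
  map_add' f g := Subtype.ext (funext fun u => map_add _ _ _)
  map_smul' a f := Subtype.ext (funext fun u => LinearMap.map_smul (scale _) a (f.1 u))

theorem pairScale_coe (c : Last ℓ y × HomFrom y → k) (f : pairModule ℓ y k) (u : Last ℓ y) :
    (pairScale ℓ c f).1 u = scale (extendWeight fun b => c (u, b)) (f.1 u) := rfl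

/-- Expanding `f` in the generators `(u, 𝟙 y)` has the values `f u` as coefficients, so `f` lies in
the ideal times `pairModule`. -/
theorem eq_zero_of_vanishesOn (l : pairModule ℓ y k →ₗ[k] k) (hl : VanishesOn (posIdeal ℓ k) l)
    (f : pairModule ℓ y k) (hf : ∀ u, f.1 u ∈ posIdeal ℓ k) : l f = 0 := by
  classical
  have : f = ∑ u, f.1 u • pairBasis ℓ k (u, ⟨y, 𝟙 y⟩) := by
    refine Subtype.ext (funext fun u => ?_)
    rw [AddSubmonoidClass.coe_finsetSum, Finset.sum_apply, Finset.sum_eq_single u]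
    · refine (f.2 u).symm.trans ?_
      change _ = f.1 u • (Pi.single u _ : Last ℓ y → CategoryAlgebra k E) u
      rw [Pi.single_eq_same]
      rfl
    · intro u' _ hu'
      change f.1 u' • (Pi.single u' _ : Last ℓ y → CategoryAlgebra k E) u = 0
      rw [Pi.single_eq_of_ne hu'.symm, smul_zero]
    · simp
  rw [this, map_sum]
  exact Finset.sum_eq_zero fun u _ => hl _ (hf u) _

/-- The group permutes the basis of pairs, so conjugating the diagonal map with entries `c p` by `h`
gives entries `c (h⁻¹ • p)`, which sum to one. A diagonal map creates no new support, hence respects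
elements supported in positive length. -/
theorem isTraceOne_pairScale {H : Type*} [Group H] [Fintype H] (φ : H ≃* Aut y)
    (c : Last ℓ y × HomFrom y → k) (hc : ∀ p, ∑ h : H, c ((φ h)⁻¹ • p) = 1) :
    IsTraceOne (posIdeal ℓ k) ((pairAct ℓ y).comp φ.toMonoidHom) (pairScale ℓ c) where
  sum_eq f := by
    refine Subtype.ext (funext fun u => coeff_ext fun m => ?_)
    rw [AddSubmonoidClass.coe_finsetSum, Finset.sum_apply, map_sum]
    by_cases hm : m.src = y
    · subst hm
      rw [← one_mul (coeff k m (f.1 u)), ← hc (u, ⟨m.tgt, m.hom⟩), Finset.sum_mul]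
      refine Finset.sum_congr rfl fun h _ => ?_
      change coeff k ⟨m.src, m.tgt, m.hom⟩ ((pairAct ℓ m.src (φ h) _).1 u) = _
      rw [pairAct_coe, coeff_mul_ofAut, pairScale_coe, coeff_scale, extendWeight_mk]
      congr 1
      change coeff k _ ((pairAct ℓ m.src (φ h⁻¹) _).1 _) = _
      rw [map_inv, pairAct_coe, coeff_mul_ofAut, inv_inv, smul_inv_smul]
      congr 2
      exact congrArg _ (Iso.inv_hom_id_assoc (φ h) m.hom)
    · rw [(mul_ofAut_one_eq_iff _).1 (f.2 u) m hm]
      exact Finset.sum_eq_zero fun h _ => (mul_ofAut_one_eq_iff _).1 ((pairAct ℓ y _ _).2 u) m hm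
  vanishes l hl j hj f := by
    refine eq_zero_of_vanishesOn ℓ l hl _ fun u => ?_
    rw [pairScale_coe, mem_posIdeal_iff]
    intro m hm
    rw [coeff_scale]
    exact (congrArg _ ((mem_posIdeal_iff ℓ _).1 (posIdeal_mul_mem ℓ hj (f.1 u)) m hm)).trans
      (mul_zero _)

/-! ### The decomposition of the ideal of morphisms of positive length -/

variable (y) in
/-- The coinvariants of `pairModule`. -/
abbrev PairCoinvariants (k : Type t) [Field k] :=
  pairModule ℓ y k ⧸ coinvariantsKer (pairAct (k := k) ℓ y)

theorem mk_pairBasis_eq {p q : Last ℓ y × HomFrom y} (h : pairComp ℓ p = pairComp ℓ q) :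
    (Submodule.Quotient.mk (pairBasis ℓ k p) : PairCoinvariants ℓ y k) =
      Submodule.Quotient.mk (pairBasis ℓ k q) := by
  obtain ⟨g, rfl⟩ := exists_smul_of_pairComp_eq ℓ h
  rw [← pairAct_pairBasis, eq_comm, Submodule.Quotient.eq]
  exact sub_mem_coinvariantsKer _ _ _

variable (y) in
open Classical in
/-- A morphism that factors through an unfactorizable morphism with target `y` is sent to the
class of the pair of its factors. -/
def splitLin (k : Type t) [Field k] : CategoryAlgebra k E →ₗ[k] PairCoinvariants ℓ y k :=
  lift k fun m => if h : ∃ p : Last ℓ y × HomFrom y, m = pairComp ℓ p then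
    Submodule.Quotient.mk (pairBasis ℓ k h.choose) else 0

theorem splitLin_pairComp (p : Last ℓ y × HomFrom y) :
    splitLin ℓ y k (of k (pairComp ℓ p)) = Submodule.Quotient.mk (pairBasis ℓ k p) := by
  have h : ∃ q : Last ℓ y × HomFrom y, pairComp ℓ p = pairComp ℓ q := ⟨p, rfl⟩
  rw [splitLin, lift_of, dif_pos h]
  exact (mk_pairBasis_eq ℓ h.choose_spec).symm

theorem splitLin_of_ne {m : TotalHom E} (h : ¬ ∃ p : Last ℓ y × HomFrom y, m = pairComp ℓ p) :
    splitLin ℓ y k (of k m) = 0 := by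
  rw [splitLin, lift_of, dif_neg h]

theorem of_smul_pairBasis {z : E} (f : Last ℓ y) {x : E} (b : y ⟶ x) (c : x ⟶ z) :
    of k ⟨x, z, c⟩ • pairBasis ℓ k (f, ⟨x, b⟩) = pairBasis ℓ k (f, ⟨z, b ≫ c⟩) := by
  classical
  apply Subtype.ext
  rw [Submodule.coe_smul, pairBasis_coe, pairBasis_coe, ← Pi.single_smul, smul_eq_mul,
    of_mul_of_comp]

theorem of_smul_pairBasis_of_ne {m : TotalHom E} {p : Last ℓ y × HomFrom y} (h : p.2.1 ≠ m.src) :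
    of k m • pairBasis ℓ k p = 0 := by
  classical
  apply Subtype.ext
  rw [Submodule.coe_smul, pairBasis_coe, ← Pi.single_smul, smul_eq_mul,
    of_mul_of_ne (α := ⟨y, p.2.1, p.2.2⟩) h, Pi.single_zero, ZeroMemClass.coe_zero]

/-- Multiplying on the left by `m` only prolongs the outgoing factor of the pair. This requires `m'`
to have an unfactorizable first factor already, which is why linearity holds only on the ideal. -/
theorem splitLin_of_mul_of (m m' : TotalHom E) (hm' : ℓ.len m'.hom ≠ 0) :
    splitLin ℓ y k (of k m * of k m') = of k m • splitLin ℓ y k (of k m') := by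
  obtain ⟨y', p, rfl⟩ := exists_pairComp_eq ℓ hm'
  obtain ⟨f, x, b⟩ := p
  by_cases h : x = m.src
  · subst h
    have h1 : of k m * of k (pairComp ℓ (f, ⟨m.src, b⟩)) =
        of k (pairComp ℓ (f, ⟨m.tgt, b ≫ m.hom⟩)) := by
      refine (of_mul_of_comp (f.2.1 ≫ b) m.hom).trans ?_
      rw [Category.assoc]; rfl
    rw [h1]
    by_cases hy : y = y'
    · subst hy
      rw [splitLin_pairComp, splitLin_pairComp, ← Submodule.Quotient.mk_smul]
      exact congrArg _ (of_smul_pairBasis ℓ f b m.hom).symm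
    · rw [splitLin_of_ne, splitLin_of_ne, smul_zero]
      · rintro ⟨q, hq⟩
        exact hy (eq_of_pairComp_eq ℓ hq).symm
      · rintro ⟨q, hq⟩
        exact hy (eq_of_pairComp_eq ℓ hq).symm
  · rw [of_mul_of_ne h, map_zero]
    by_cases hy : y = y'
    · subst hy
      rw [splitLin_pairComp, ← Submodule.Quotient.mk_smul, of_smul_pairBasis_of_ne ℓ h]
      rfl
    · rw [splitLin_of_ne, smul_zero]
      rintro ⟨q, hq⟩
      exact hy (eq_of_pairComp_eq ℓ hq).symm

theorem splitLin_mul (b a : CategoryAlgebra k E) (ha : a ∈ posIdeal ℓ k) :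
    splitLin ℓ y k (b * a) = b • splitLin ℓ y k a := by
  replace ha := mem_span_of_mem_posIdeal ℓ ha
  induction ha using Submodule.span_induction with
  | zero => rw [mul_zero, map_zero, smul_zero]
  | add a a' _ _ iha ihb => rw [mul_add, map_add, map_add, iha, ihb, smul_add]
  | smul c a _ ih =>
    rw [mul_smul_comm, map_smul, map_smul, ih]
    exact (smul_algebra_smul_comm c b _).symm
  | mem a h =>
    obtain ⟨m', hm', rfl⟩ := h
    induction b using induction_of with
    | zero => rw [zero_mul, map_zero, zero_smul]
    | add a a' iha ihb => rw [add_mul, map_add, iha, ihb, add_smul]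
    | smul c a ih => rw [smul_mul_assoc, map_smul, ih, smul_assoc]
    | of m => exact splitLin_of_mul_of ℓ m m' hm'

variable (y) in
/-- The restriction of `splitLin` to the ideal, where it is linear over the category algebra. -/
def splitMap (k : Type t) [Field k] :
    posIdeal ℓ k →ₗ[CategoryAlgebra k E] PairCoinvariants ℓ y k where
  toFun a := splitLin ℓ y k a.1
  map_add' _ _ := map_add _ _ _
  map_smul' b a := splitLin_mul ℓ b a.1 a.2

variable (y) in
/-- The map that sends the basis element of a pair to its composite. -/
def joinLin (k : Type t) [Field k] :
    pairModule ℓ y k →ₗ[CategoryAlgebra k E] posIdeal ℓ k :=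
  LinearMap.codRestrict (posIdeal ℓ k)
    (∑ u : Last ℓ y, LinearMap.toSpanSingleton _ _ (of k ⟨u.1, y, u.2.1⟩) ∘ₗ
      LinearMap.proj u ∘ₗ (pairModule ℓ y k).subtype) fun f => by
    rw [LinearMap.sum_apply]
    refine Submodule.sum_mem _ fun u _ => Ideal.mul_mem_left _ _ (of_mem_posIdeal ℓ ?_)
    rw [u.2.2]
    exact one_ne_zero

theorem joinLin_coe (f : pairModule ℓ y k) :
    (joinLin ℓ y k f : CategoryAlgebra k E) = ∑ u : Last ℓ y, f.1 u * of k ⟨u.1, y, u.2.1⟩ := by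
  change (∑ u : Last ℓ y, LinearMap.toSpanSingleton (CategoryAlgebra k E) _
    (of k ⟨u.1, y, u.2.1⟩) ∘ₗ LinearMap.proj u ∘ₗ (pairModule ℓ y k).subtype) f = _
  rw [LinearMap.sum_apply]
  rfl

theorem joinLin_pairAct (g : Aut y) (f : pairModule ℓ y k) :
    joinLin ℓ y k (pairAct ℓ y g f) = joinLin ℓ y k f := by
  apply Subtype.ext
  rw [joinLin_coe, joinLin_coe, ← Equiv.sum_comp (MulAction.toPerm g)]
  refine Finset.sum_congr rfl fun u _ => ?_
  rw [pairAct_coe, MulAction.toPerm_apply, inv_smul_smul, mul_assoc]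
  congr 1
  refine (of_mul_of_comp _ _).trans ?_
  congr 2
  exact (Category.assoc _ _ _).trans ((congrArg _ (Iso.hom_inv_id g)).trans (Category.comp_id _))

variable (y) in
/-- The map induced by `joinLin` on the coinvariants. -/
def joinMap (k : Type t) [Field k] :
    PairCoinvariants ℓ y k →ₗ[CategoryAlgebra k E] posIdeal ℓ k :=
  (coinvariantsKer (pairAct (k := k) ℓ y)).liftQ (joinLin ℓ y k) (by
    refine Submodule.span_le.2 ?_
    rintro _ ⟨g, f, rfl⟩
    rw [SetLike.mem_coe, LinearMap.mem_ker, map_sub, joinLin_pairAct, sub_self])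

theorem joinMap_mk_pairBasis (p : Last ℓ y × HomFrom y) :
    (joinMap ℓ y k (Submodule.Quotient.mk (pairBasis ℓ k p)) : CategoryAlgebra k E) =
      of k (pairComp ℓ p) := by
  classical
  change (joinLin ℓ y k (pairBasis ℓ k p) : CategoryAlgebra k E) = _
  rw [joinLin_coe, Finset.sum_eq_single p.1]
  · rw [pairBasis_coe, Pi.single_eq_same]
    exact of_mul_of_comp _ _
  · intro u _ hu
    rw [pairBasis_coe, Pi.single_eq_of_ne hu, zero_mul]
  · simp

/-- A morphism of positive length belongs to exactly one block `y`, where splitting and recomposing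
returns it. Exhibiting the ideal as a retract of the sum of the blocks is enough for `Ext` to
vanish. -/
theorem sum_joinMap_splitMap [Fintype E] :
    ∑ y : E, joinMap ℓ y k ∘ₗ splitMap ℓ y k = LinearMap.id := by
  refine LinearMap.ext fun a => Subtype.ext ?_
  have h : ∀ a : posIdeal ℓ k, ((∑ y : E, joinMap ℓ y k ∘ₗ splitMap ℓ y k) a).1 =
      ∑ y : E, (joinMap ℓ y k (splitLin ℓ y k a.1)).1 := fun a => by
    rw [LinearMap.sum_apply, AddSubmonoidClass.coe_finsetSum]
    rfl
  rw [h, LinearMap.id_apply]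
  obtain ⟨a, ha⟩ := a
  simp only
  replace ha := mem_span_of_mem_posIdeal ℓ ha
  induction ha using Submodule.span_induction with
  | zero => simp
  | add a a' _ _ iha ihb =>
    simp only [map_add, Submodule.coe_add, Finset.sum_add_distrib, iha, ihb]
  | smul c a _ ih =>
    conv_rhs => rw [← ih, Finset.smul_sum]
    refine Finset.sum_congr rfl fun y _ => ?_
    rw [map_smul, LinearMap.map_smul_of_tower]
    rfl
  | mem a h =>
    obtain ⟨m, hm, rfl⟩ := h
    obtain ⟨y, p, rfl⟩ := exists_pairComp_eq ℓ hm
    rw [Finset.sum_eq_single y]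
    · rw [splitLin_pairComp, joinMap_mk_pairBasis]
    · intro y' _ hy'
      rw [splitLin_of_ne, map_zero, ZeroMemClass.coe_zero]
      rintro ⟨q, hq⟩
      exact hy' (eq_of_pairComp_eq ℓ hq).symm
    · simp

end CategoryAlgebra

/-! ### The vanishing of `Ext` in degrees at least two -/

theorem ext_eq_zero_of_sum_eq_id {A : Type u} [Ring A] {N : Type u} [AddCommGroup N] [Module A N]
    {ι : Type*} [Fintype ι] (M : ι → Type u) [∀ i, AddCommGroup (M i)] [∀ i, Module A (M i)]
    (p : ∀ i, N →ₗ[A] M i) (q : ∀ i, M i →ₗ[A] N) (h : ∑ i, q i ∘ₗ p i = LinearMap.id)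
    {S : ModuleCat.{u} A} {n : ℕ} (hM : ∀ i (e : Abelian.Ext (ModuleCat.of A (M i)) S n), e = 0)
    (e : Abelian.Ext (ModuleCat.of A N) S n) : e = 0 := by
  have hid : 𝟙 (ModuleCat.of A N) =
      ∑ i, ModuleCat.ofHom (p i) ≫ ModuleCat.ofHom (q i) := by
    ext1
    rw [ModuleCat.hom_sum]
    exact h.symm
  rw [← Abelian.Ext.mk₀_id_comp e, hid, Abelian.Ext.mk₀_sum, Abelian.Ext.sum_comp]
  refine Finset.sum_eq_zero fun i _ => ?_
  rw [← Abelian.Ext.mk₀_comp_mk₀_assoc, hM i (Abelian.Ext.comp _ _ _), Abelian.Ext.comp_zero]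

namespace CategoryAlgebra

variable {k : Type t} [Field k] {E : Type u} [Category.{v} E] [FiniteEICategory E]
  (ℓ : LengthFunction E)

theorem ext_pairCoinvariants_eq_zero {y : E}
    (hy : IsLeftRegularObj k y ∨ IsRightRegularObj k y) {n : ℕ}
    (e : Abelian.Ext (ModuleCat.of (CategoryAlgebra k E) (PairCoinvariants ℓ y k))
      (ModuleCat.of (CategoryAlgebra k E) (CategoryAlgebra k E ⧸ posIdeal ℓ k)) (n + 1)) :
    e = 0 := by
  have := Fintype.ofFinite (Aut y)
  -- The group is lifted to the universe of the modules, as `ext_coinvariants_eq_zero` requires.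
  have := Fintype.ofFinite (ULift.{max t u v} (Aut y))
  obtain ⟨c, hc⟩ := exists_weight (isUnit_card_stabilizer (k := k) ℓ hy)
  have := projective_pairModule (k := k) ℓ y
  let φ : ULift.{max t u v} (Aut y) ≃* Aut y := MulEquiv.ulift
  have hT := isTraceOne_pairScale ℓ φ c fun p => by
    rw [← hc p]
    exact Equiv.sum_comp Equiv.ulift (fun g : Aut y => c (g⁻¹ • p))
  have hS := isDualOfQuotient (k := k) ℓ
  refine ext_coinvariants_eq_zero
    (S := ModuleCat.of (CategoryAlgebra k E) (CategoryAlgebra k E ⧸ posIdeal ℓ k))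
    hS n (pairModule ℓ y k) _ _ hT (PairCoinvariants ℓ y k)
    (coinvariantsKer (pairAct (k := k) ℓ y)).mkQ (Submodule.mkQ_surjective _) ?_ e
  · rw [Submodule.ker_mkQ]
    unfold coinvariantsKer
    congr 1
    ext z
    constructor
    · rintro ⟨g, f, rfl⟩
      exact ⟨⟨g⟩, f, rfl⟩
    · rintro ⟨g, f, rfl⟩
      exact ⟨g.down, f, rfl⟩

theorem ext_quotient_eq_zero (hreg : ∀ x : E, IsLeftRegularObj k x ∨ IsRightRegularObj k x) {n : ℕ}
    (e : Abelian.Ext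
      (ModuleCat.of (CategoryAlgebra k E) (CategoryAlgebra k E ⧸ posIdeal ℓ k))
      (ModuleCat.of (CategoryAlgebra k E) (CategoryAlgebra k E ⧸ posIdeal ℓ k)) (n + 2)) :
    e = 0 := by
  have : Finite E := FiniteEICategory.finite_obj E
  have := Fintype.ofFinite E
  -- Stated for any `N` equal to the ideal, because dimension shifting produces the kernel of the
  -- quotient map, which is the ideal only up to a propositional equality.
  have key : ∀ (N : Ideal (CategoryAlgebra k E)) (_ : N = posIdeal ℓ k)
      (e : Abelian.Ext (ModuleCat.of (CategoryAlgebra k E) N)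
        (ModuleCat.of (CategoryAlgebra k E) (CategoryAlgebra k E ⧸ posIdeal ℓ k)) (n + 1)),
      e = 0 := by
    rintro N rfl e
    exact ext_eq_zero_of_sum_eq_id (fun y => PairCoinvariants ℓ y k) (fun y => splitMap ℓ y k)
      (fun y => joinMap ℓ y k) (sum_joinMap_splitMap ℓ)
      (fun y e => ext_pairCoinvariants_eq_zero ℓ (hreg y) e) e
  obtain ⟨e', rfl⟩ := ext_succ_eq_extClass_comp (Submodule.mkQ_surjective (posIdeal ℓ k)) e
  rw [key _ (Submodule.ker_mkQ _) e']
  exact Abelian.Ext.comp_zero _ _ _ _ _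

end CategoryAlgebra
end

theorem theorem4p3p12 (k : Type t) [Field k] (E : Type u) [Category.{v} E] [FiniteEICategory E]
    (hfree : IsFreeEI.{w} E)
    (hreg : ∀ x : E, IsLeftRegularObj k x ∨ IsRightRegularObj k x) :
    ∃ _ : GradedAlgebra (CategoryAlgebra.lengthGrading k E),
      IsQuasiKoszulAlgebra (CategoryAlgebra.lengthGrading k E) := by
  obtain ⟨ℓ⟩ := hfree.nonempty_lengthFunction
  refine ⟨CategoryAlgebra.gradedAlgebra ℓ, fun i => ?_⟩
  rw [eq_top_iff]
  intro z _
  cases i with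
  | zero =>
    -- In degree one, `z` is its own Yoneda product with the identity in `Ext⁰`.
    exact AddSubgroup.subset_closure ⟨z, Abelian.Ext.mk₀ (𝟙 _), (Abelian.Ext.mk₀_id_comp z).symm⟩
  | succ n =>
    have hz : z = 0 := CategoryAlgebra.ext_quotient_eq_zero ℓ hreg z
    rw [hz]
    exact AddSubgroup.zero_mem _
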